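/- **Setting.** Let $\mathcal M=(\mathcal S,\mathcal A,R,p,H)$ be a finite-horizon MDP with time-independent dynamics, finite state and action sets of cardinalities $S$ and $A$, horizon $H\ge 1$, transition probabilities $p(s'\mid s,a)$, and random rewards $R(s,a)\in[0,1]$ with mean $r(s,a)$. For a deterministic policy $\pi:\mathcal S\times[H]\to\mathcal A$ let $V^\pi_t(s)=\mathbb E\big[\sum_{t'=t}^H r(s_{t'},\pi(s_{t'},t'))\mid s_t=s\big]$ under $\pi$, and $V^*_t(s)=\max_\pi V^\pi_t(s)$. An agent plays episodes $k=1,\dots,K$ ($K\ge 1$) of $H$ steps. The initial state $s_1^k$ of each episode is arbitrary (it may depend on the past). In episode $k$ the agent follows a policy $\pi_k$ determined before the episode starts, i.e. $a_t^k=\pi_k(s_t^k,t)$, receives a reward distributed as $R(s_t^k,a_t^k)$ and observes $s_{t+1}^k\sim p(\cdot\mid s_t^k,a_t^k)$. **Algorithm (UCRL2 with Greedy Policies).** Fix $\delta\in(0,1)$. Let $n_{k}(s,a)$ be the number of visits to $(s,a)$ in the first $k$ episodes, and let $\hat r_k(s,a)$ and $\hat p_k(\cdot\mid s,a)$ be the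 empirical mean reward and the empirical transition frequencies from these visits (set to $0$ if $n_k(s,a)=0$). Initialize $\bar V^0_t(s)=H-(t-1)$ for $t\in[H]$, and $\bar V^k_{H+1}=0$ for all $k$. For a state $s$, a time-step $t$ and an action $a$ put $$\bar Q^k_t(s,a)=\hat r_{k-1}(s,a)+\sqrt{\frac{2\ln\frac{8SAKH}{\delta}}{n_{k-1}(s,a)\vee 1}}+\max_{P'\in CI_{k-1}(s,a)}\sum_{s'}P'(s')\,\bar V^{k-1}_{t+1}(s'),$$ where $CI_{k-1}(s,a)$ is the set of probability distributions $P'$ on $\mathcal S$ with $$\big\|P'-\hat p_{k-1}(\cdot\mid s,a)\big\|_1\le\sqrt{\frac{4S\ln\frac{12SAKH}{\delta}}{n_{k-1}(s,a)\vee 1}}.$$ In episode $k$ the policy is greedy, $\pi_k(s,t)\in\arg\max_a\bar Q^k_t(s,a)$ (ties broken arbitrarily), and the values of the visited states are updated by $\bar V^k_t(s_t^k)=\min\{\bar V^{k-1}_t(s_t^k),\bar Q^k_t(s_t^k,a_t^k)\}$, while $\bar V^k_t(s)=\bar V^{k-1}_t(s)$ for $s\ne s^k_t$. **Theorem.** There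 are absolute constants $C>0$ and $m\in\mathbb N$ such that, for every such MDP, every $K\ge1$, every $\delta\in(0,1)$ and every time $T\le KH$, with probability at least $1-\delta$ the regret of UCRL2 with Greedy Policies up to time $T$ satisfies $$\sum_{k=1}^{\lceil T/H\rceil}\big(V_1^*(s_1^k)-V_1^{\pi_k}(s_1^k)\big)\;\le\; C\,\big(HS\sqrt{AT}+H^2\sqrt S\,SA\big)\,\ln^m\!\Big(\frac{2SAHK}{\delta}\Big).$$ -/

import Mathlib

open MeasureTheory ProbabilityTheory
open scoped ENNReal

/-- A finite-horizon Markov decision process with time-independent dynamics on the state space `S`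
and the action space `A` (the horizon is carried separately): transition probabilities
`p(· | s, a)` and the laws of the random rewards `R(s, a) ∈ [0, 1]`. -/
structure FiniteMDP (S A : Type*) where
  trans : S → A → PMF S
  reward : S → A → ProbabilityMeasure unitInterval

namespace FiniteMDP

variable {S A : Type*} [Fintype S]

/-- The expected reward `r(s, a) = 𝔼 R(s, a)`. -/
noncomputable def meanReward (M : FiniteMDP S A) (s : S) (a : A) : ℝ :=
  ∫ x : unitInterval, (x : ℝ) ∂(M.reward s a : Measure unitInterval)

/-- The law of the state `s_{t+n}` given `s_t = s`, when the actions are those of the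
deterministic policy `π` (`π t s` is the action at time-step `t` in state `s`). -/
noncomputable def stateLaw (M : FiniteMDP S A) (π : ℕ → S → A) (t : ℕ) (s : S) : ℕ → PMF S
  | 0 => PMF.pure s
  | n + 1 => (stateLaw M π t s n).bind fun x => M.trans x (π (t + n) x)

/-- The value `V_t^π(s) = 𝔼 [∑_{t'} r(s_{t'}, π(s_{t'}, t')) | s_t = s]`, the sum running over the
time-steps `t' ≥ t` of the episode. Time-steps are numbered from `0` to `H - 1`. -/
noncomputable def value (M : FiniteMDP S A) (H : ℕ) (π : ℕ → S → A) (t : ℕ) (s : S) : ℝ :=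
  ∑ n ∈ Finset.range (H - t),
    ∑ x, (M.stateLaw π t s n x).toReal * M.meanReward x (π (t + n) x)

/-- The optimal value `V_t^*(s) = max_π V_t^π(s)`. -/
noncomputable def optValue (M : FiniteMDP S A) (H t : ℕ) (s : S) : ℝ :=
  ⨆ π : ℕ → S → A, M.value H π t s

end FiniteMDP

/-- The data of a sequence of episodes. For the episode `k` (numbered from `0`) and `t < H`,
`state k t`, `action k t` and `reward k t` are the state, the action and the reward at time-step `t`
(numbered from `0`), and `state k (t + 1)` is the state observed after that action; in particular
`state k H` is the last observation of the episode. -/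
structure Trajectory (S A : Type*) where
  state : ℕ → ℕ → S
  action : ℕ → ℕ → A
  reward : ℕ → ℕ → unitInterval

namespace Trajectory

variable {S A : Type*} [Fintype S] [Fintype A] [DecidableEq S] [DecidableEq A]

/-- The time-steps `(i, t)` of the first `k` episodes at which `a` is played in `s`. -/
def visitTimes (H : ℕ) (h : Trajectory S A) (k : ℕ) (s : S) (a : A) : Finset (ℕ × ℕ) :=
  (Finset.range k ×ˢ Finset.range H).filter
    fun q => h.state q.1 q.2 = s ∧ h.action q.1 q.2 = a

/-- The number of visits `n_k(s, a)` in the first `k` episodes. -/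
def visits (H : ℕ) (h : Trajectory S A) (k : ℕ) (s : S) (a : A) : ℕ :=
  (h.visitTimes H k s a).card

/-- The empirical mean reward after `k` episodes (it is `0` as long as there are no samples). -/
noncomputable def empReward (H : ℕ) (h : Trajectory S A) (k : ℕ) (s : S) (a : A) : ℝ :=
  (∑ q ∈ h.visitTimes H k s a, (h.reward q.1 q.2 : ℝ)) / (h.visits H k s a : ℝ)

/-- The empirical transition frequencies after `k` episodes (they are `0` as long as there are no
samples). -/
noncomputable def empTrans (H : ℕ) (h : Trajectory S A) (k : ℕ) (s : S) (a : A) (x : S) : ℝ :=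
  (((h.visitTimes H k s a).filter fun q => h.state q.1 (q.2 + 1) = x).card : ℝ) /
    (h.visits H k s a : ℝ)

/-- The optimistic reward `r̃ = r̂ + √(2 log (8 S A T / δ) / (n ∨ 1))`, where `T = K H`. -/
noncomputable def optReward (H K : ℕ) (δ : ℝ) (h : Trajectory S A) (k : ℕ) (s : S) (a : A) : ℝ :=
  h.empReward H k s a +
    Real.sqrt (2 * Real.log (8 * Fintype.card S * Fintype.card A * (K * H : ℝ) / δ) /
      (max (h.visits H k s a) 1 : ℕ))

/-- The confidence set `CI(s, a)`: the probability vectors on `S` at `L¹` distance at most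
`√(4 S log (12 S A T / δ) / (n ∨ 1))` from the empirical transition probabilities, `T = K H`. -/
def confSet (H K : ℕ) (δ : ℝ) (h : Trajectory S A) (k : ℕ) (s : S) (a : A) : Set (S → ℝ) :=
  {P | P ∈ stdSimplex ℝ S ∧
    ∑ x, |P x - h.empTrans H k s a x| ≤
      Real.sqrt (4 * Fintype.card S *
          Real.log (12 * Fintype.card S * Fintype.card A * (K * H : ℝ) / δ) /
        (max (h.visits H k s a) 1 : ℕ))}

/-- The optimistic Q-function `r̃(s, a) + max_{P ∈ CI(s, a)} Pᵀ v`, computed from the first `k`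
episodes and a value vector `v` for the next time-step. -/
noncomputable def optQ (H K : ℕ) (δ : ℝ) (h : Trajectory S A) (k : ℕ) (s : S) (a : A)
    (v : S → ℝ) : ℝ :=
  h.optReward H K δ k s a + sSup ((fun P : S → ℝ => ∑ x, P x * v x) '' h.confSet H K δ k s a)

/-- The optimistic value `V̄^k_t` held after `k` episodes. It starts at the number of remaining
time-steps (`0` at `t = H`), and in each episode only the visited states are updated. -/
noncomputable def optV (H K : ℕ) (δ : ℝ) (h : Trajectory S A) : ℕ → ℕ → S → ℝ
  | 0, t, _ => ((H - t : ℕ) : ℝ)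
  | k + 1, t, s =>
    if t < H ∧ s = h.state k t then
      min (optV H K δ h k t s) (h.optQ H K δ k s (h.action k t) (optV H K δ h k (t + 1)))
    else optV H K δ h k t s

/-- The supremum in `optQ` is a maximum: the optimistic transition `p̃ ∈ argmax` exists. -/
theorem exists_optTrans (H K : ℕ) (hH : 1 ≤ H) (hK : 1 ≤ K) (δ : ℝ) (hδ : 0 < δ) (hδ1 : δ < 1)
    (h : Trajectory S A) (k : ℕ) (s : S) (a : A) (v : S → ℝ) :
    ∃ P ∈ h.confSet H K δ k s a,
      h.optQ H K δ k s a v = h.optReward H K δ k s a + ∑ x, P x * v x := by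
  have hne : (h.confSet H K δ k s a).Nonempty := by
    by_cases hn : h.visits H k s a = 0
    · classical
      refine ⟨Pi.single s 1, single_mem_stdSimplex ℝ s, ?_⟩
      have h0 : ∀ x, h.empTrans H k s a x = 0 := fun x => by simp [empTrans, hn]
      have h1 : ∑ x, |(Pi.single s (1 : ℝ) : S → ℝ) x - h.empTrans H k s a x| = 1 := by
        rw [Finset.sum_eq_single s]
        · simp [h0]
        · intro b _ hb
          simp [h0, hb]
        · simp
      rw [h1, hn]
      have : Nonempty S := ⟨s⟩
      have : Nonempty A := ⟨a⟩
      have hS : (1 : ℝ) ≤ Fintype.card S := by exact_mod_cast Fintype.card_pos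
      have hA : (1 : ℝ) ≤ Fintype.card A := by exact_mod_cast Fintype.card_pos
      have hT : (1 : ℝ) ≤ K * H := by exact_mod_cast Nat.mul_pos hK hH
      have hSA : (1 : ℝ) ≤ Fintype.card S * Fintype.card A := one_le_mul_of_one_le_of_one_le hS hA
      have hSAT : (1 : ℝ) ≤ Fintype.card S * Fintype.card A * (K * H : ℝ) :=
        one_le_mul_of_one_le_of_one_le hSA hT
      have hx : (12 : ℝ) ≤ 12 * Fintype.card S * Fintype.card A * (K * H : ℝ) / δ := by
        rw [le_div_iff₀ hδ]
        nlinarith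
      have hlog : (1 : ℝ) ≤ Real.log (12 * Fintype.card S * Fintype.card A * (K * H : ℝ) / δ) := by
        rw [Real.le_log_iff_exp_le (by linarith)]
        have := Real.exp_one_lt_d9
        linarith
      apply Real.le_sqrt_of_sq_le
      norm_num
      nlinarith [one_le_mul_of_one_le_of_one_le hS hlog]
    · have hpos : (0 : ℝ) < h.visits H k s a := by exact_mod_cast Nat.pos_of_ne_zero hn
      refine ⟨h.empTrans H k s a, ⟨fun x => by unfold empTrans; positivity, ?_⟩, ?_⟩
      · simp only [empTrans]
        rw [← Finset.sum_div, div_eq_one_iff_eq hpos.ne', visits]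
        exact_mod_cast (Finset.card_eq_sum_card_fiberwise
          (f := fun q : ℕ × ℕ => h.state q.1 (q.2 + 1)) (t := Finset.univ)
          (fun _ _ => Finset.mem_coe.2 (Finset.mem_univ _))).symm
      · simp only [sub_self, abs_zero, Finset.sum_const_zero]
        exact Real.sqrt_nonneg _
  have hc : IsCompact (h.confSet H K δ k s a) := by
    refine (isCompact_stdSimplex ℝ S).inter_right (isClosed_le (f := fun P : S → ℝ =>
      ∑ x, |P x - h.empTrans H k s a x|) (by fun_prop) continuous_const)
  obtain ⟨P, hP, hmax⟩ := hc.exists_sSup_image_eq hne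
    (f := fun P : S → ℝ => ∑ x, P x * v x) (by fun_prop)
  exact ⟨P, hP, by rw [optQ, hmax]⟩

end Trajectory

section Interaction

variable {S A Ω : Type*} [Fintype S] [MeasurableSpace S] [MeasurableSpace A]
  {mΩ : MeasurableSpace Ω}

/-- An agent plays the MDP `M` for `K` episodes of `H` steps, following in the episode `k` the
deterministic policy `π k`, which is chosen before the episode starts. Here `ℱ (k * (H + 1) + t)`
is the information available when the state at time-step `t ≤ H` of the episode `k` has been
observed. The initial states are arbitrary (they may depend on the past and on extra randomness).
Given that information, the next state and the reward have the laws prescribed by `M`. -/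
structure EpisodicInteraction (M : FiniteMDP S A) (H K : ℕ) (μ : Measure Ω)
    (ℱ : Filtration ℕ mΩ) (X : Ω → Trajectory S A) (π : ℕ → Ω → ℕ → S → A) : Prop where
  measurable_state : ∀ k < K, ∀ t ≤ H,
    Measurable[ℱ (k * (H + 1) + t)] fun ω => (X ω).state k t
  measurable_reward : ∀ k < K, ∀ t < H,
    Measurable[ℱ (k * (H + 1) + (t + 1))] fun ω => (X ω).reward k t
  measurable_policy : ∀ k < K, ∀ t < H, ∀ s,
    Measurable[ℱ (k * (H + 1))] fun ω => π k ω t s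
  action_eq : ∀ k < K, ∀ t < H, ∀ ω, (X ω).action k t = π k ω t ((X ω).state k t)
  trans_law : ∀ k < K, ∀ t < H, ∀ x : S,
    μ⟦{ω | (X ω).state k (t + 1) = x} | ℱ (k * (H + 1) + t)⟧ =ᵐ[μ]
      fun ω => (M.trans ((X ω).state k t) ((X ω).action k t) x).toReal
  reward_law : ∀ k < K, ∀ t < H, ∀ B : Set unitInterval, MeasurableSet B →
    μ⟦{ω | (X ω).reward k t ∈ B} | ℱ (k * (H + 1) + t)⟧ =ᵐ[μ]
      fun ω => (M.reward ((X ω).state k t) ((X ω).action k t) : Measure unitInterval).real B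

/-- The policies are those of UCRL2 with greedy policies, run with the parameters `K` and `δ`:
in each episode `k`, at each time-step `t` and in each state `s`, the action maximizes the optimistic
Q-function built from the data of the previous episodes and the optimistic value `V̄_{t+1}` held at
the end of the previous episode (ties are broken arbitrarily). -/
def IsUCRL2GP [Fintype A] [DecidableEq S] [DecidableEq A] (H K : ℕ) (δ : ℝ)
    (X : Ω → Trajectory S A) (π : ℕ → Ω → ℕ → S → A) : Prop :=
  ∀ k < K, ∀ t < H, ∀ ω s a,
    (X ω).optQ H K δ k s a ((X ω).optV H K δ k (t + 1)) ≤
      (X ω).optQ H K δ k s (π k ω t s) ((X ω).optV H K δ k (t + 1))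

/-- The regret up to time `T`: the sum of `V_1^*(s_1^k) - V_1^{π_k}(s_1^k)` over all the episodes
that have been started within the first `T` time-steps, of which there are `⌈T / H⌉`. -/
noncomputable def regret (M : FiniteMDP S A) (H : ℕ) (X : Ω → Trajectory S A)
    (π : ℕ → Ω → ℕ → S → A) (T : ℕ) (ω : Ω) : ℝ :=
  ∑ k ∈ Finset.range (T ⌈/⌉ H),
    (M.optValue H 0 ((X ω).state k 0) - M.value H (π k ω) 0 ((X ω).state k 0))

end Interaction

/-! Suppose that, before every episode, all empirical rewards and transition frequencies lie within
their confidence widths. Then every policy's value is below the optimistic value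
(`Trajectory.value_le_optV`): an update takes the minimum of a valid upper bound and a greedy
one-step lookahead, which dominates the Bellman backup of any policy. The regret of episode `k` is
therefore at most the surplus of the optimistic value over the value of `π k` at the initial state.

Follow this surplus along the episode actually played (`Trajectory.surplus_le`). One step splits it
into the drop of the optimistic value at the visited state, a confidence bonus of order `H √(S log)
/ √n`, a martingale difference, and the surplus at the next observed state. Telescoping in `t`
leaves three sums. The drops total at most `S H ^ 2`, because each of the `S H` optimistic values is
nonincreasing and stays in `[0, H]`; this is what makes one-step planning affordable. The bonuses
are summed by a pigeonhole argument (`Trajectory.sum_inv_sqrt_visits_le`) and give the main term and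
the lower-order term. The martingale is controlled by Azuma-Hoeffding.

The probabilistic input is one exponential supermartingale bound, `measureReal_sum_ge_le_exp`, for
increments that vanish off predictable events. Applied to the visits of a fixed pair, on the event
that there are exactly `n` of them, it bounds the empirical means although the sampling is adaptive.
Union bounds over episodes, pairs, counts, and signs or sign vectors finish the argument. -/

/-! ### Hoeffding's inequality with predictable supports -/

section Concentration

/-- The chord of `x ↦ exp (l * x)` over `[a, b]`, evaluated at `0`, satisfies Hoeffding's bound. -/
theorem chord_exp_le {a b : ℝ} (ha : a ≤ 0) (hb : 0 ≤ b) (hab : a < b) (l : ℝ) :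
    b / (b - a) * Real.exp (l * a) + -a / (b - a) * Real.exp (l * b) ≤
      Real.exp (l ^ 2 * (b - a) ^ 2 / 8) := by
  have hw : 0 < b - a := sub_pos.2 hab
  have hp : 0 ≤ b / (b - a) := by positivity
  have hq : 0 ≤ -a / (b - a) := div_nonneg (by linarith) hw.le
  have hpq : b / (b - a) + -a / (b - a) = 1 := by field_simp; ring
  -- The centred law on `{a, b}`: its moment generating function is the chord value, so Hoeffding's
  -- lemma for bounded centred variables gives the bound.
  set ν : Measure ℝ := ENNReal.ofReal (b / (b - a)) • Measure.dirac a +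
    ENNReal.ofReal (-a / (b - a)) • Measure.dirac b with hν
  have hint : ∀ f : ℝ → ℝ, ∫ x, f x ∂ν = b / (b - a) * f a + -a / (b - a) * f b := by
    intro f
    rw [hν, integral_add_measure, integral_smul_measure, integral_smul_measure, integral_dirac,
      integral_dirac, ENNReal.toReal_ofReal hp, ENNReal.toReal_ofReal hq, smul_eq_mul, smul_eq_mul]
    · exact (integrable_dirac (by simp)).smul_measure ENNReal.ofReal_ne_top
    · exact (integrable_dirac (by simp)).smul_measure ENNReal.ofReal_ne_top
  have hprob : IsProbabilityMeasure ν := by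
    constructor
    simp only [hν, Measure.add_apply, Measure.smul_apply, measure_univ, smul_eq_mul, mul_one]
    rw [← ENNReal.ofReal_add hp hq, hpq, ENNReal.ofReal_one]
  have hmem : ∀ᵐ x ∂ν, id x ∈ Set.Icc a b := by
    rw [hν, ae_add_measure_iff]
    constructor <;> refine Measure.ae_smul_measure ?_ _ <;> rw [ae_dirac_eq] <;>
      simp [hab.le]
  have h := (hasSubgaussianMGF_of_mem_Icc_of_integral_eq_zero (X := id) (μ := ν) aemeasurable_id
    hmem (by rw [hint]; simp only [id]; field_simp; ring)).mgf_le l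
  rw [mgf, hint] at h
  refine h.trans (Real.exp_le_exp.2 (le_of_eq ?_))
  simp only [NNReal.coe_pow, NNReal.coe_div, coe_nnnorm, Real.norm_eq_abs, abs_of_pos hw,
    NNReal.coe_ofNat]
  ring

/-- Convexity of `exp`, with the chord split into its value at `0` and a term linear in `y`; the
linear term disappears when `y` is conditionally centred. -/
theorem exp_le_chord {a b : ℝ} (hab : a < b) (l : ℝ) {y : ℝ} (hy : y ∈ Set.Icc a b) :
    Real.exp (l * y) ≤ (b / (b - a) * Real.exp (l * a) + -a / (b - a) * Real.exp (l * b)) +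
      (Real.exp (l * b) - Real.exp (l * a)) / (b - a) * y := by
  have hw : 0 < b - a := sub_pos.2 hab
  have h := convexOn_exp.2 (Set.mem_univ (l * a)) (Set.mem_univ (l * b))
    (div_nonneg (sub_nonneg.2 hy.2) hw.le) (div_nonneg (sub_nonneg.2 hy.1) hw.le)
    (by field_simp; ring)
  simp only [smul_eq_mul] at h
  have hw' := hw.ne'
  have e : (b - y) / (b - a) * (l * a) + (y - a) / (b - a) * (l * b) = l * y := by
    field_simp; ring
  rw [e] at h
  refine h.trans (le_of_eq ?_)
  field_simp
  ring

theorem measurable_exp_sub_indicator {Ω : Type*} {m : MeasurableSpace Ω} {Y : Ω → ℝ} {D : Set Ω}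
    (hY : Measurable Y) (hD : MeasurableSet D) (l c : ℝ) :
    Measurable fun ω => Real.exp (l * Y ω - c * D.indicator 1 ω) :=
  ((hY.const_mul l).sub ((measurable_one.indicator hD).const_mul c)).exp

variable {Ω : Type*} {m mΩ : MeasurableSpace Ω} {μ : Measure Ω}

/-- A conditional form of Hoeffding's lemma, normalized so that nothing is lost where `Y`
vanishes. -/
theorem integral_mul_exp_le_of_condExp_eq_zero [IsProbabilityMeasure μ] (hm : m ≤ mΩ)
    {W Y : Ω → ℝ} {D : Set Ω} {a b : ℝ} (ha : a ≤ 0) (hb : 0 ≤ b) (hab : a < b)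
    (hW : Measurable[m] W) (hW0 : ∀ ω, 0 ≤ W ω) (hWi : Integrable W μ)
    (hY : Measurable Y) (hYab : ∀ ω, Y ω ∈ Set.Icc a b) (hD : MeasurableSet[m] D)
    (hYD : ∀ ω ∉ D, Y ω = 0) (hc : μ[Y | m] =ᵐ[μ] 0) (l : ℝ) :
    Integrable (fun ω => W ω *
        Real.exp (l * Y ω - l ^ 2 * (b - a) ^ 2 / 8 * D.indicator 1 ω)) μ ∧
      ∫ ω, W ω * Real.exp (l * Y ω - l ^ 2 * (b - a) ^ 2 / 8 * D.indicator 1 ω) ∂μ ≤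
        ∫ ω, W ω ∂μ := by
  set c : ℝ := l ^ 2 * (b - a) ^ 2 / 8 with hcdef
  have hc0 : 0 ≤ c := by positivity
  set β : ℝ := (Real.exp (l * b) - Real.exp (l * a)) / (b - a) * Real.exp (-c) with hβ
  have hYabs : ∀ ω, |Y ω| ≤ |a| + |b| := fun ω => by
    obtain ⟨h1, h2⟩ := hYab ω
    rw [abs_le]
    constructor <;> linarith [neg_abs_le a, neg_abs_le b, le_abs_self a, le_abs_self b,
      abs_nonneg a, abs_nonneg b]
  have hWY : Integrable (W * Y) μ := hWi.mul_bdd hY.aestronglyMeasurable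
    (Filter.Eventually.of_forall hYabs)
  have hYi : Integrable Y μ := Integrable.of_bound hY.aestronglyMeasurable _
    (Filter.Eventually.of_forall hYabs)
  have hmeas : Measurable fun ω => Real.exp (l * Y ω - c * D.indicator 1 ω) :=
    measurable_exp_sub_indicator hY (hm _ hD) l c
  have hint : Integrable (fun ω => W ω * Real.exp (l * Y ω - c * D.indicator 1 ω)) μ := by
    refine hWi.mul_bdd (c := Real.exp (|l| * (|a| + |b|))) hmeas.aestronglyMeasurable
      (Filter.Eventually.of_forall fun ω => ?_)
    rw [Real.norm_eq_abs, Real.abs_exp, Real.exp_le_exp]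
    have h1 : l * Y ω ≤ |l| * (|a| + |b|) := (le_abs_self _).trans <| by
      rw [abs_mul]; exact mul_le_mul_of_nonneg_left (hYabs ω) (abs_nonneg l)
    have h2 : (0 : ℝ) ≤ D.indicator 1 ω := Set.indicator_nonneg (fun _ _ => zero_le_one) ω
    nlinarith [mul_nonneg hc0 h2]
  refine ⟨hint, ?_⟩
  have hpt : ∀ ω, W ω * Real.exp (l * Y ω - c * D.indicator 1 ω) ≤ W ω + β * (W * Y) ω := by
    intro ω
    -- On `D` this is the chord bound multiplied by `exp (-c)`; off `D` both sides equal `1`. After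
    -- integration against `W` the `β` term is zero.
    have : Real.exp (l * Y ω - c * D.indicator 1 ω) ≤ 1 + β * Y ω := by
      by_cases hω : ω ∈ D
      · have h1 := (exp_le_chord hab l (hYab ω)).trans
          (add_le_add_left (chord_exp_le ha hb hab l) _)
        have h2 := mul_le_mul_of_nonneg_right h1 (Real.exp_pos (-c)).le
        rw [← Real.exp_add, add_mul, ← Real.exp_add, add_neg_cancel, Real.exp_zero] at h2
        simp only [Set.indicator_of_mem hω, Pi.one_apply, mul_one]
        rw [sub_eq_add_neg]
        refine h2.trans (le_of_eq ?_)
        rw [hβ]; ring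
      · simp [Set.indicator_of_notMem hω, hYD ω hω]
    calc _ ≤ W ω * (1 + β * Y ω) := mul_le_mul_of_nonneg_left this (hW0 ω)
      _ = _ := by simp only [Pi.mul_apply]; ring
  have hzero : ∫ ω, (W * Y) ω ∂μ = 0 := by
    rw [← integral_condExp hm, integral_eq_zero_of_ae]
    filter_upwards [condExp_mul_of_stronglyMeasurable_left hW.stronglyMeasurable hWY hYi, hc]
      with ω h1 h2
    rw [h1, Pi.mul_apply, h2]; simp
  calc _ ≤ ∫ ω, (W ω + β * (W * Y) ω) ∂μ :=
        integral_mono hint (hWi.add (hWY.const_mul β)) hpt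
    _ = _ := by
        rw [integral_add hWi (hWY.const_mul β), integral_const_mul, hzero]; simp

/-- The compensated exponential is a supermartingale started at `1`, and its compensator grows only
at indices where `D i` occurs. Measurability and integrability are carried along because the next
step uses this process as the weight `W`. -/
theorem integral_exp_sum_le_one [IsProbabilityMeasure μ] {ℱ : Filtration ℕ mΩ}
    {Y : ℕ → Ω → ℝ} {D : ℕ → Set Ω} {a b : ℝ} (ha : a ≤ 0) (hb : 0 ≤ b) (hab : a < b)
    (hY : ∀ i, Measurable[ℱ (i + 1)] (Y i)) (hYab : ∀ i ω, Y i ω ∈ Set.Icc a b)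
    (hD : ∀ i, MeasurableSet[ℱ i] (D i)) (hYD : ∀ i, ∀ ω ∉ D i, Y i ω = 0)
    (hc : ∀ i, μ[Y i | ℱ i] =ᵐ[μ] 0) (l : ℝ) (n : ℕ) :
    Measurable[ℱ n] (fun ω => Real.exp (∑ i ∈ Finset.range n,
        (l * Y i ω - l ^ 2 * (b - a) ^ 2 / 8 * (D i).indicator 1 ω))) ∧
    Integrable (fun ω => Real.exp (∑ i ∈ Finset.range n,
        (l * Y i ω - l ^ 2 * (b - a) ^ 2 / 8 * (D i).indicator 1 ω))) μ ∧
      ∫ ω, Real.exp (∑ i ∈ Finset.range n,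
        (l * Y i ω - l ^ 2 * (b - a) ^ 2 / 8 * (D i).indicator 1 ω)) ∂μ ≤ 1 := by
  induction n with
  | zero => simp
  | succ n ih =>
    obtain ⟨h1, h2, h3⟩ := ih
    have h := integral_mul_exp_le_of_condExp_eq_zero (ℱ.le n) ha hb hab h1
      (fun ω => (Real.exp_pos _).le) h2 ((hY n).mono (ℱ.le _) le_rfl) (hYab n) (hD n) (hYD n)
      (hc n) l
    simp only [Finset.sum_range_succ, Real.exp_add]
    exact ⟨(Measurable.fun_mul (h1.mono (ℱ.mono n.le_succ) le_rfl)
      (measurable_exp_sub_indicator (hY n) (ℱ.mono n.le_succ _ (hD n)) _ _) :),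
      h.1, h.2.trans h3⟩

/-- A Hoeffding inequality for martingale differences that vanish off the predictable events
`D i`, on the event that at most `v` of the `D i` occur. -/
theorem measureReal_sum_ge_le_exp [IsProbabilityMeasure μ] {ℱ : Filtration ℕ mΩ}
    {Y : ℕ → Ω → ℝ} {D : ℕ → Set Ω} {a b : ℝ} (ha : a ≤ 0) (hb : 0 ≤ b) (hab : a < b)
    (hY : ∀ i, Measurable[ℱ (i + 1)] (Y i)) (hYab : ∀ i ω, Y i ω ∈ Set.Icc a b)
    (hD : ∀ i, MeasurableSet[ℱ i] (D i)) (hYD : ∀ i, ∀ ω ∉ D i, Y i ω = 0)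
    (hc : ∀ i, μ[Y i | ℱ i] =ᵐ[μ] 0) (n : ℕ) {x v : ℝ} (hx : 0 ≤ x) (hv : 0 < v) :
    μ.real {ω | x ≤ ∑ i ∈ Finset.range n, Y i ω ∧
        ∑ i ∈ Finset.range n, (D i).indicator (1 : Ω → ℝ) ω ≤ v} ≤
      Real.exp (-(2 * x ^ 2 / (v * (b - a) ^ 2))) := by
  have hw : 0 < b - a := sub_pos.2 hab
  -- The maximizer of `l x - l ^ 2 (b - a) ^ 2 v / 8`, which is the Chernoff exponent.
  set l : ℝ := 4 * x / (v * (b - a) ^ 2) with hl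
  have hl0 : 0 ≤ l := by positivity
  obtain ⟨-, h2, h3⟩ := integral_exp_sum_le_one ha hb hab hY hYab hD hYD hc l n
  have h4 := mul_meas_ge_le_integral_of_nonneg (μ := μ)
    (Filter.Eventually.of_forall fun ω => (Real.exp_pos _).le) h2
    (Real.exp (2 * x ^ 2 / (v * (b - a) ^ 2)))
  have hsub : {ω | x ≤ ∑ i ∈ Finset.range n, Y i ω ∧
        ∑ i ∈ Finset.range n, (D i).indicator (1 : Ω → ℝ) ω ≤ v} ⊆
      {ω | Real.exp (2 * x ^ 2 / (v * (b - a) ^ 2)) ≤ Real.exp (∑ i ∈ Finset.range n,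
        (l * Y i ω - l ^ 2 * (b - a) ^ 2 / 8 * (D i).indicator 1 ω))} := by
    rintro ω ⟨hω1, hω2⟩
    simp only [Set.mem_ofPred_eq, Real.exp_le_exp]
    rw [Finset.sum_sub_distrib, ← Finset.mul_sum, ← Finset.mul_sum]
    have e1 := mul_le_mul_of_nonneg_left hω1 hl0
    have e2 := mul_le_mul_of_nonneg_left hω2
      (show 0 ≤ l ^ 2 * (b - a) ^ 2 / 8 by positivity)
    have e3 : 2 * x ^ 2 / (v * (b - a) ^ 2) = l * x - l ^ 2 * (b - a) ^ 2 / 8 * v := by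
      rw [hl]; field_simp; ring
    linarith
  rw [Real.exp_neg, ← one_div, le_div_iff₀ (Real.exp_pos _), mul_comm]
  exact (mul_le_mul_of_nonneg_left (measureReal_mono hsub) (Real.exp_pos _).le).trans
    (h4.trans h3)

end Concentration

/-! ### Finite averages and the Bellman equation -/

theorem PMF.sum_toReal_eq_one {S : Type*} [Fintype S] (p : PMF S) : ∑ x, (p x).toReal = 1 := by
  rw [← ENNReal.toReal_sum fun x _ => p.apply_ne_top x, ← tsum_fintype (L := .unconditional S),
    p.tsum_coe, ENNReal.toReal_one]

theorem PMF.bind_apply_toReal {S T : Type*} [Fintype S] (p : PMF S) (f : S → PMF T) (y : T) :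
    (p.bind f y).toReal = ∑ x, (p x).toReal * (f x y).toReal := by
  rw [PMF.bind_apply, tsum_fintype,
    ENNReal.toReal_sum fun x _ => ENNReal.mul_ne_top (p.apply_ne_top x) ((f x).apply_ne_top y)]
  simp [ENNReal.toReal_mul]

/-- An average of numbers in `[0, c]` is in `[0, c]`. -/
theorem PMF.sum_toReal_mul_mem_Icc {S : Type*} [Fintype S] (p : PMF S) {f : S → ℝ} {c : ℝ}
    (hf : ∀ x, f x ∈ Set.Icc 0 c) : ∑ x, (p x).toReal * f x ∈ Set.Icc 0 c := by
  constructor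
  · exact Finset.sum_nonneg fun x _ => mul_nonneg ENNReal.toReal_nonneg (hf x).1
  · calc ∑ x, (p x).toReal * f x ≤ ∑ x, (p x).toReal * c :=
          Finset.sum_le_sum fun x _ => mul_le_mul_of_nonneg_left (hf x).2 ENNReal.toReal_nonneg
      _ = c := by rw [← Finset.sum_mul, p.sum_toReal_eq_one, one_mul]

namespace FiniteMDP

variable {S A : Type*} (M : FiniteMDP S A)

theorem meanReward_mem_Icc (s : S) (a : A) : M.meanReward s a ∈ Set.Icc (0 : ℝ) 1 := by
  refine ⟨integral_nonneg fun x => x.2.1, ?_⟩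
  have h : M.meanReward s a ≤ ∫ _ : unitInterval, (1 : ℝ) ∂(M.reward s a : Measure unitInterval) :=
    integral_mono_of_nonneg (Filter.Eventually.of_forall fun x => x.2.1) (integrable_const _)
      (Filter.Eventually.of_forall fun x => x.2.2)
  simpa using h

/-- The definition peels off the last transition; the Bellman equation needs the first one peeled
off instead. -/
theorem stateLaw_succ (π : ℕ → S → A) (t : ℕ) (s : S) (n : ℕ) :
    M.stateLaw π t s (n + 1) =
      (M.trans s (π t s)).bind fun x => M.stateLaw π (t + 1) x n := by
  induction n with
  | zero => simp [stateLaw]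
  | succ n ih =>
    rw [stateLaw, ih, PMF.bind_bind]
    refine congrArg _ (funext fun x => ?_)
    rw [stateLaw, show t + (n + 1) = t + 1 + n by ring]

variable [Fintype S]

theorem value_of_le (H : ℕ) (π : ℕ → S → A) {t : ℕ} (ht : H ≤ t) (s : S) :
    M.value H π t s = 0 := by
  simp [value, Nat.sub_eq_zero_of_le ht]

/-- The Bellman equation of a deterministic policy. -/
theorem value_eq_add (H : ℕ) (π : ℕ → S → A) {t : ℕ} (ht : t < H) (s : S) :
    M.value H π t s = M.meanReward s (π t s) +
      ∑ x, (M.trans s (π t s) x).toReal * M.value H π (t + 1) x := by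
  classical
  obtain ⟨n, rfl⟩ := Nat.exists_eq_add_of_lt ht
  rw [value, show t + n + 1 - t = n + 1 by omega, Finset.sum_range_succ', add_comm]
  congr 1
  · rw [Finset.sum_eq_single s] <;> simp +contextual [stateLaw]
  · simp only [value, show t + n + 1 - (t + 1) = n by omega, Finset.mul_sum]
    refine Eq.trans (Finset.sum_congr rfl fun i _ => ?_) Finset.sum_comm
    simp only [M.stateLaw_succ, PMF.bind_apply_toReal, Finset.sum_mul]
    rw [Finset.sum_comm]
    refine Finset.sum_congr rfl fun x _ => Finset.sum_congr rfl fun y _ => ?_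
    rw [show t + (i + 1) = t + 1 + i by ring, mul_assoc]

theorem value_mem_Icc (H : ℕ) (π : ℕ → S → A) (t : ℕ) (s : S) :
    M.value H π t s ∈ Set.Icc (0 : ℝ) (H - t : ℕ) := by
  have h : ∀ n ∈ Finset.range (H - t),
      ∑ x, (M.stateLaw π t s n x).toReal * M.meanReward x (π (t + n) x) ∈ Set.Icc (0 : ℝ) 1 :=
    fun n _ => (M.stateLaw π t s n).sum_toReal_mul_mem_Icc fun x => M.meanReward_mem_Icc _ _
  refine ⟨Finset.sum_nonneg fun n hn => (h n hn).1, ?_⟩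
  simpa [value] using Finset.sum_le_sum fun n hn => (h n hn).2

end FiniteMDP

/-! ### Bounds and monotonicity of the optimistic values -/

namespace Trajectory

variable {S A : Type*} [Fintype S] [Fintype A] [DecidableEq S] [DecidableEq A]
variable (H K : ℕ) (δ : ℝ) (h : Trajectory S A)

theorem optReward_nonneg (k : ℕ) (s : S) (a : A) : 0 ≤ h.optReward H K δ k s a := by
  refine add_nonneg (div_nonneg (Finset.sum_nonneg fun q _ => (h.reward q.1 q.2).2.1)
    (Nat.cast_nonneg _)) (Real.sqrt_nonneg _)

theorem optQ_nonneg (k : ℕ) (s : S) (a : A) {v : S → ℝ} (hv : ∀ x, 0 ≤ v x) :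
    0 ≤ h.optQ H K δ k s a v := by
  refine add_nonneg (h.optReward_nonneg H K δ k s a) (Real.sSup_nonneg ?_)
  rintro _ ⟨P, hP, rfl⟩
  exact Finset.sum_nonneg fun x _ => mul_nonneg (hP.1.1 x) (hv x)

theorem optV_nonneg (k t : ℕ) (s : S) : 0 ≤ h.optV H K δ k t s := by
  induction k generalizing t s with
  | zero => simp [optV]
  | succ k ih =>
    rw [optV]
    split_ifs
    · exact le_min (ih t s) (h.optQ_nonneg H K δ k s _ (ih (t + 1)))
    · exact ih t s

theorem optV_succ_le (k t : ℕ) (s : S) : h.optV H K δ (k + 1) t s ≤ h.optV H K δ k t s := by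
  rw [optV]
  split_ifs
  · exact min_le_left _ _
  · exact le_rfl

theorem optV_le (k t : ℕ) (s : S) : h.optV H K δ k t s ≤ (H - t : ℕ) := by
  induction k with
  | zero => simp [optV]
  | succ k ih => exact (h.optV_succ_le H K δ k t s).trans ih

theorem optV_of_le (k : ℕ) {t : ℕ} (ht : H ≤ t) (s : S) : h.optV H K δ k t s = 0 :=
  le_antisymm (by simpa [Nat.sub_eq_zero_of_le ht] using h.optV_le H K δ k t s)
    (h.optV_nonneg H K δ k t s)

/-- Along a trajectory the optimistic values decrease by at most `S * H ^ 2` in total. -/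
theorem sum_optV_sub_le (N : ℕ) :
    ∑ k ∈ Finset.range N, ∑ t ∈ Finset.range H,
      (h.optV H K δ k t (h.state k t) - h.optV H K δ (k + 1) t (h.state k t)) ≤
      Fintype.card S * (H : ℝ) ^ 2 := by
  rw [Finset.sum_comm]
  have h1 : ∀ t ∈ Finset.range H, ∑ k ∈ Finset.range N,
      (h.optV H K δ k t (h.state k t) - h.optV H K δ (k + 1) t (h.state k t)) ≤
        Fintype.card S * (H : ℝ) := by
    intro t _
    -- The visited state varies with `k`, so its drop alone does not telescope; drops at all states
    -- are nonnegative, and their sum does.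
    calc _ ≤ ∑ k ∈ Finset.range N, ∑ s, (h.optV H K δ k t s - h.optV H K δ (k + 1) t s) :=
          Finset.sum_le_sum fun k _ => Finset.single_le_sum
            (f := fun s => h.optV H K δ k t s - h.optV H K δ (k + 1) t s)
            (fun s _ => sub_nonneg.2 (h.optV_succ_le H K δ k t s)) (Finset.mem_univ _)
      _ = ∑ s, (h.optV H K δ 0 t s - h.optV H K δ N t s) := by
          rw [Finset.sum_comm]
          exact Finset.sum_congr rfl fun s _ =>
            Finset.sum_range_sub' (fun k => h.optV H K δ k t s) N
      _ ≤ ∑ _s : S, (H : ℝ) := Finset.sum_le_sum fun s _ => by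
          have := h.optV_nonneg H K δ N t s
          have h2 : h.optV H K δ 0 t s ≤ H :=
            (h.optV_le H K δ 0 t s).trans (by exact_mod_cast Nat.sub_le H t)
          linarith
      _ = _ := by simp
  calc _ ≤ ∑ _t ∈ Finset.range H, Fintype.card S * (H : ℝ) := Finset.sum_le_sum h1
    _ = _ := by simp; ring

end Trajectory

/-! ### Visit counts and the pigeonhole principle -/

namespace Trajectory

variable {S A : Type*} [DecidableEq S] [DecidableEq A] (H : ℕ) (h : Trajectory S A)

/-- A sum over the first `k + 1` episodes splits off the last episode. -/
theorem sum_visitTimes {E : Type*} [AddCommMonoid E] (f : ℕ × ℕ → E) (k : ℕ) (s : S) (a : A) :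
    ∑ q ∈ h.visitTimes H k s a, f q = ∑ j ∈ Finset.range k, ∑ t ∈ Finset.range H,
      if h.state j t = s ∧ h.action j t = a then f (j, t) else 0 := by
  rw [visitTimes, Finset.sum_filter, Finset.sum_product]

theorem visits_eq_sum (k : ℕ) (s : S) (a : A) :
    h.visits H k s a = ∑ j ∈ Finset.range k, ∑ t ∈ Finset.range H,
      if h.state j t = s ∧ h.action j t = a then 1 else 0 := by
  rw [visits, Finset.card_eq_sum_ones, sum_visitTimes]

theorem visits_succ (k : ℕ) (s : S) (a : A) :
    h.visits H (k + 1) s a = h.visits H k s a +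
      ∑ t ∈ Finset.range H, if h.state k t = s ∧ h.action k t = a then 1 else 0 := by
  rw [visits_eq_sum, visits_eq_sum, Finset.sum_range_succ]

theorem visits_le (k : ℕ) (s : S) (a : A) : h.visits H k s a ≤ k * H := by
  refine (Finset.card_filter_le _ _).trans ?_
  simp

theorem sum_visits [Fintype S] [Fintype A] (k : ℕ) : ∑ s, ∑ a, h.visits H k s a = k * H := by
  simp only [visits_eq_sum]
  rw [← Finset.sum_product', Finset.sum_comm]
  simp_rw [Finset.sum_comm (s := (Finset.univ : Finset S) ×ˢ (Finset.univ : Finset A))]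
  have h1 : ∀ j t : ℕ, ∑ x ∈ (Finset.univ : Finset S) ×ˢ (Finset.univ : Finset A),
      (if h.state j t = x.1 ∧ h.action j t = x.2 then 1 else 0) = 1 := fun j t => by
    rw [Finset.sum_eq_single (h.state j t, h.action j t)]
    · simp
    · rintro ⟨s, a⟩ _ hne
      rw [if_neg]
      rintro ⟨rfl, rfl⟩
      exact hne rfl
    · simp
  simp only [h1]
  simp

/-- The potential argument behind the pigeonhole principle when the counts are only refreshed
after blocks of length at most `H`. -/
theorem div_sqrt_max_le {H n m : ℕ} (hm : m ≤ H) :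
    (m : ℝ) / √(max n 1 : ℕ) ≤ (3 * √(n + m : ℕ) + min (n + m : ℝ) (2 * H)) -
      (3 * √(n : ℝ) + min (n : ℝ) (2 * H)) := by
  have hmono : √(n : ℝ) ≤ √(n + m : ℕ) := Real.sqrt_le_sqrt (by exact_mod_cast Nat.le_add_right n m)
  -- While `n < H` the left side is at most `m`, paid for by the truncated linear term since `n + m
  -- ≤ 2 H`. Once `n ≥ H`, the count at most doubles within a block, so `√(n + m) + √n ≤ 3 √n`;
  -- hence the constant `3`.
  rcases lt_or_ge n H with hn | hn
  · have hnm : (n : ℝ) + m ≤ 2 * H := by exact_mod_cast (by omega : n + m ≤ 2 * H)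
    have hn' : (n : ℝ) ≤ 2 * H := by exact_mod_cast (by omega : n ≤ 2 * H)
    rw [min_eq_left hnm, min_eq_left hn']
    have h1 : (1 : ℝ) ≤ √(max n 1 : ℕ) := by
      rw [Real.one_le_sqrt]; exact_mod_cast le_max_right n 1
    have := div_le_self (Nat.cast_nonneg (α := ℝ) m) h1
    linarith
  · have h2 : min (n : ℝ) (2 * H) ≤ min (n + m : ℝ) (2 * H) :=
      min_le_min_right _ (by linarith [Nat.cast_nonneg (α := ℝ) m])
    rcases Nat.eq_zero_or_pos m with rfl | hm0
    · simp
    have hn1 : max n 1 = n := max_eq_left (by omega)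
    rw [hn1]
    have hnpos : (0 : ℝ) < n := by exact_mod_cast (by omega : 0 < n)
    have hsq : 0 < √(n : ℝ) := Real.sqrt_pos.2 hnpos
    have h3 : √(n + m : ℕ) ≤ 2 * √(n : ℝ) := by
      rw [Real.sqrt_le_left (by positivity), mul_pow, Real.sq_sqrt hnpos.le]
      exact_mod_cast (by omega : n + m ≤ 2 ^ 2 * n)
    have h4 : (m : ℝ) = (√(n + m : ℕ) - √(n : ℝ)) * (√(n + m : ℕ) + √(n : ℝ)) := by
      have e1 := Real.mul_self_sqrt (Nat.cast_nonneg (α := ℝ) (n + m))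
      have e2 := Real.mul_self_sqrt hnpos.le
      push_cast at e1 ⊢
      linarith
    have h5 : (m : ℝ) / √(n : ℝ) ≤ 3 * (√(n + m : ℕ) - √(n : ℝ)) := by
      rw [div_le_iff₀ hsq]
      nlinarith
    linarith

/-- The count is frozen during an episode, so each inner sum is a block of at most `H` equal terms,
bounded by the increment of the potential. The potential telescopes over episodes, and `2 H` is the
cap of its linear part. -/
theorem sum_div_sqrt_visits_le (N : ℕ) (s : S) (a : A) :
    ∑ k ∈ Finset.range N, ∑ t ∈ Finset.range H,
      (if h.state k t = s ∧ h.action k t = a then 1 / √(max (h.visits H k s a) 1 : ℕ) else 0) ≤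
      3 * √(h.visits H N s a : ℝ) + 2 * H := by
  set c : ℕ → ℕ := fun k =>
    ∑ t ∈ Finset.range H, if h.state k t = s ∧ h.action k t = a then 1 else 0 with hc
  have hcH : ∀ k, c k ≤ H := fun k => by
    simp only [hc, ← Finset.card_filter]
    exact (Finset.card_filter_le _ _).trans (by simp)
  have h1 : ∀ k ∈ Finset.range N, ∑ t ∈ Finset.range H,
      (if h.state k t = s ∧ h.action k t = a then 1 / √(max (h.visits H k s a) 1 : ℕ) else 0) ≤
      (3 * √(h.visits H (k + 1) s a : ℝ) + min (h.visits H (k + 1) s a : ℝ) (2 * H)) -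
        (3 * √(h.visits H k s a : ℝ) + min (h.visits H k s a : ℝ) (2 * H)) := fun k _ => by
    have e : ∑ t ∈ Finset.range H, (if h.state k t = s ∧ h.action k t = a then
        1 / √(max (h.visits H k s a) 1 : ℕ) else 0) = c k / √(max (h.visits H k s a) 1 : ℕ) := by
      simp only [hc, Nat.cast_sum, Finset.sum_div]
      refine Finset.sum_congr rfl fun t _ => ?_
      split_ifs <;> simp
    rw [e, h.visits_succ H k s a]
    have := div_sqrt_max_le (n := h.visits H k s a) (hcH k)
    push_cast at this ⊢
    simpa [hc] using this
  refine (Finset.sum_le_sum h1).trans ?_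
  rw [Finset.sum_range_sub (fun k => 3 * √(h.visits H k s a : ℝ) +
    min (h.visits H k s a : ℝ) (2 * H))]
  have h0 : h.visits H 0 s a = 0 := by simp [visits_eq_sum]
  rw [h0]
  have := min_le_right (h.visits H N s a : ℝ) (2 * H)
  have h2 : min (0 : ℝ) (2 * H) = 0 := min_eq_left (by positivity)
  simp only [Nat.cast_zero, Real.sqrt_zero, h2]
  linarith

/-- The pigeonhole principle for the inverse square roots of the visit counts. -/
theorem sum_inv_sqrt_visits_le [Fintype S] [Fintype A] (N : ℕ) :
    ∑ k ∈ Finset.range N, ∑ t ∈ Finset.range H,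
      1 / √(max (h.visits H k (h.state k t) (h.action k t)) 1 : ℕ) ≤
      3 * √(Fintype.card S * Fintype.card A * (N * H : ℝ)) +
        2 * H * Fintype.card S * Fintype.card A := by
  have h1 : ∀ k t, 1 / √(max (h.visits H k (h.state k t) (h.action k t)) 1 : ℕ) =
      ∑ x : S × A, (if h.state k t = x.1 ∧ h.action k t = x.2 then
        1 / √(max (h.visits H k x.1 x.2) 1 : ℕ) else 0) := fun k t => by
    rw [Finset.sum_eq_single (h.state k t, h.action k t)]
    · simp
    · rintro ⟨s, a⟩ _ hne
      rw [if_neg]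
      rintro ⟨rfl, rfl⟩
      exact hne rfl
    · simp
  simp only [h1]
  have h2 : ∀ k, ∑ t ∈ Finset.range H, ∑ x : S × A, (if h.state k t = x.1 ∧ h.action k t = x.2 then
        1 / √(max (h.visits H k x.1 x.2) 1 : ℕ) else 0) =
      ∑ x : S × A, ∑ t ∈ Finset.range H, (if h.state k t = x.1 ∧ h.action k t = x.2 then
        1 / √(max (h.visits H k x.1 x.2) 1 : ℕ) else 0) := fun k => Finset.sum_comm
  simp only [h2]
  rw [Finset.sum_comm]
  refine (Finset.sum_le_sum fun x _ => h.sum_div_sqrt_visits_le H N x.1 x.2).trans ?_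
  rw [Finset.sum_add_distrib, ← Finset.mul_sum]
  have h3 : ∑ x : S × A, √(h.visits H N x.1 x.2 : ℝ) ≤
      √(Fintype.card S * Fintype.card A * (N * H : ℝ)) := by
    apply Real.le_sqrt_of_sq_le
    refine sq_sum_le_card_mul_sum_sq.trans (le_of_eq ?_)
    simp only [Real.sq_sqrt (Nat.cast_nonneg _), Finset.card_univ, Fintype.card_prod]
    rw [Fintype.sum_prod_type]
    push_cast
    congr 1
    exact_mod_cast h.sum_visits H N
  have h4 : ∑ _x : S × A, (2 * H : ℝ) = 2 * H * Fintype.card S * Fintype.card A := by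
    simp [Fintype.card_prod]; ring
  rw [h4]
  linarith

end Trajectory

/-! ### Optimism and the regret decomposition on the concentration event -/

namespace Trajectory

variable {S A : Type*} [Fintype S] [Fintype A] [DecidableEq S] [DecidableEq A]

/-- All the empirical rewards and transition frequencies held before the episodes `k < K` are
within their confidence widths of the true ones. -/
structure Concentrated (M : FiniteMDP S A) (H K : ℕ) (δ : ℝ) (h : Trajectory S A) : Prop where
  reward : ∀ k < K, ∀ s a, |h.empReward H k s a - M.meanReward s a| ≤
    √(2 * Real.log (8 * Fintype.card S * Fintype.card A * (K * H : ℝ) / δ) /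
      (max (h.visits H k s a) 1 : ℕ))
  trans : ∀ k < K, ∀ s a, (fun x => (M.trans s a x).toReal) ∈ h.confSet H K δ k s a

/-- The actions are greedy with respect to the optimistic Q-functions. -/
def IsGreedy (H K : ℕ) (δ : ℝ) (h : Trajectory S A) (p : ℕ → ℕ → S → A) : Prop :=
  ∀ k < K, ∀ t < H, ∀ s a, h.optQ H K δ k s a (h.optV H K δ k (t + 1)) ≤
    h.optQ H K δ k s (p k t s) (h.optV H K δ k (t + 1))

variable {M : FiniteMDP S A} {H K : ℕ} {δ : ℝ} {h : Trajectory S A} {p : ℕ → ℕ → S → A}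

theorem sum_mul_le_sSup_confSet {k : ℕ} {s : S} {a : A} (v : S → ℝ) {P : S → ℝ}
    (hP : P ∈ h.confSet H K δ k s a) :
    ∑ x, P x * v x ≤ sSup ((fun P : S → ℝ => ∑ x, P x * v x) '' h.confSet H K δ k s a) := by
  refine le_csSup ⟨∑ x, |v x|, ?_⟩ ⟨P, hP, rfl⟩
  rintro _ ⟨Q, hQ, rfl⟩
  refine Finset.sum_le_sum fun x _ => ?_
  have h1 : Q x ≤ 1 := by
    rw [← hQ.1.2]
    exact Finset.single_le_sum (fun y _ => hQ.1.1 y) (Finset.mem_univ x)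
  calc Q x * v x ≤ Q x * |v x| := mul_le_mul_of_nonneg_left (le_abs_self _) (hQ.1.1 x)
    _ ≤ 1 * |v x| := mul_le_mul_of_nonneg_right h1 (abs_nonneg _)
    _ = |v x| := one_mul _

/-- Optimism: the values of all the policies are below the optimistic values. -/
theorem value_le_optV (hc : h.Concentrated M H K δ) (hg : h.IsGreedy H K δ p)
    (ha : ∀ k < K, ∀ t < H, h.action k t = p k t (h.state k t)) {k : ℕ} (hk : k ≤ K)
    (π : ℕ → S → A) (t : ℕ) (s : S) : M.value H π t s ≤ h.optV H K δ k t s := by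
  -- The lookahead at `t` uses the values at `t + 1` from the previous episode, so induction on `k`
  -- alone suffices, with no backward induction on `t`.
  induction k generalizing t s with
  | zero => exact (M.value_mem_Icc H π t s).2
  | succ k ih =>
    have hk' : k < K := hk
    rw [optV]
    split_ifs with hts
    · obtain ⟨ht, rfl⟩ := hts
      refine le_min (ih hk'.le t _) ?_
      rw [ha k hk' t ht, M.value_eq_add H π ht]
      -- Greediness replaces the played action by that of the comparison policy, for which the
      -- optimistic lookahead dominates the Bellman backup.
      refine le_trans (add_le_add ?_ ?_) (hg k hk' t ht (h.state k t) (π t (h.state k t)))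
      · have := (abs_le.1 (hc.reward k hk' (h.state k t) (π t (h.state k t)))).1
        rw [optReward]
        linarith
      · refine le_trans (Finset.sum_le_sum fun x _ => ?_)
          (sum_mul_le_sSup_confSet _ (hc.trans k hk' (h.state k t) (π t (h.state k t))))
        exact mul_le_mul_of_nonneg_left (ih hk'.le (t + 1) x) ENNReal.toReal_nonneg
    · exact ih hk'.le t s

/-- The optimistic surplus of the policy `π` before the episode `k`. -/
noncomputable def surplus (M : FiniteMDP S A) (H K : ℕ) (δ : ℝ) (h : Trajectory S A) (k : ℕ)
    (π : ℕ → S → A) (t : ℕ) (x : S) : ℝ :=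
  h.optV H K δ k t x - M.value H π t x

theorem surplus_of_le {k t : ℕ} (ht : H ≤ t) (π : ℕ → S → A) (x : S) :
    h.surplus M H K δ k π t x = 0 := by
  rw [surplus, h.optV_of_le H K δ k ht, M.value_of_le H π ht, sub_zero]

theorem surplus_mem_Icc (k : ℕ) (π : ℕ → S → A) (t : ℕ) (x : S) :
    h.surplus M H K δ k π t x ∈ Set.Icc (-H : ℝ) H := by
  have h1 := h.optV_nonneg H K δ k t x
  have h2 := h.optV_le H K δ k t x
  have h3 := M.value_mem_Icc H π t x
  have h4 : ((H - t : ℕ) : ℝ) ≤ H := by exact_mod_cast Nat.sub_le H t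
  rw [surplus]
  constructor <;> linarith [h3.1, h3.2]

/-- The martingale difference at the time-step `t` of the episode `k`. -/
noncomputable def surplusDrift (M : FiniteMDP S A) (H K : ℕ) (δ : ℝ) (h : Trajectory S A)
    (p : ℕ → ℕ → S → A) (k t : ℕ) : ℝ :=
  ∑ x, (M.trans (h.state k t) (h.action k t) x).toReal * h.surplus M H K δ k (p k) (t + 1) x -
    h.surplus M H K δ k (p k) (t + 1) (h.state k (t + 1))

/-- The updated optimistic value is at most the lookahead at the played action; subtract from it the
Bellman equation of the played policy. The reward gap costs two reward widths. The optimistic and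
true kernels are both within one `L¹` width of the empirical one, and the optimistic values are at
most `H`, so the kernel gap costs `2 H` widths. Replacing the true expectation of the next surplus
by its realized value leaves the drift. -/
theorem surplus_le (hH : 1 ≤ H) (hK : 1 ≤ K) (hδ : 0 < δ) (hδ1 : δ < 1)
    (hc : h.Concentrated M H K δ)
    (ha : ∀ k < K, ∀ t < H, h.action k t = p k t (h.state k t)) {k t : ℕ} (hk : k < K)
    (ht : t < H) :
    h.surplus M H K δ k (p k) t (h.state k t) ≤
      (h.optV H K δ k t (h.state k t) - h.optV H K δ (k + 1) t (h.state k t)) +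
      (2 * √(2 * Real.log (8 * Fintype.card S * Fintype.card A * (K * H : ℝ) / δ)) +
        2 * H * √(4 * Fintype.card S *
          Real.log (12 * Fintype.card S * Fintype.card A * (K * H : ℝ) / δ))) *
        (1 / √(max (h.visits H k (h.state k t) (h.action k t)) 1 : ℕ)) +
      h.surplusDrift M H K δ p k t +
      h.surplus M H K δ k (p k) (t + 1) (h.state k (t + 1)) := by
  set s := h.state k t with hs
  set a := h.action k t with hadef
  set v := h.optV H K δ k (t + 1) with hv
  obtain ⟨P, hP, hPQ⟩ := exists_optTrans H K hH hK δ hδ hδ1 h k s a v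
  have h1 : h.optV H K δ (k + 1) t s ≤ h.optReward H K δ k s a + ∑ x, P x * v x := by
    rw [optV, if_pos ⟨ht, hs⟩, ← hPQ]
    exact min_le_right _ _
  have h2 : M.value H (p k) t s = M.meanReward s a +
      ∑ x, (M.trans s a x).toReal * M.value H (p k) (t + 1) x := by
    rw [M.value_eq_add H (p k) ht, hadef, ha k hk t ht]
  have h3 := (abs_le.1 (hc.reward k hk s a)).2
  have hv0 : ∀ x, |v x| ≤ H := fun x => by
    rw [abs_of_nonneg (h.optV_nonneg H K δ k (t + 1) x)]
    exact (h.optV_le H K δ k (t + 1) x).trans (by exact_mod_cast Nat.sub_le _ _)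
  have h4 : ∑ x, P x * v x - ∑ x, (M.trans s a x).toReal * v x ≤
      2 * H * √(4 * Fintype.card S *
          Real.log (12 * Fintype.card S * Fintype.card A * (K * H : ℝ) / δ) /
        (max (h.visits H k s a) 1 : ℕ)) := by
    rw [← Finset.sum_sub_distrib]
    calc ∑ x, (P x * v x - (M.trans s a x).toReal * v x)
        ≤ ∑ x, (|P x - h.empTrans H k s a x| +
            |(M.trans s a x).toReal - h.empTrans H k s a x|) * H := by
          refine Finset.sum_le_sum fun x _ => ?_
          rw [← sub_mul]
          refine (le_abs_self _).trans ?_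
          rw [abs_mul]
          refine mul_le_mul ?_ (hv0 x) (abs_nonneg _) (by positivity)
          rw [abs_sub_comm (M.trans s a x).toReal]
          exact abs_sub_le _ _ _
      _ = H * (∑ x, |P x - h.empTrans H k s a x| +
            ∑ x, |(M.trans s a x).toReal - h.empTrans H k s a x|) := by
          rw [← Finset.sum_mul, Finset.sum_add_distrib, mul_comm]
      _ ≤ H * (_ + _) := mul_le_mul_of_nonneg_left
          (add_le_add hP.2 (hc.trans k hk s a).2) (Nat.cast_nonneg _)
      _ = _ := by ring
  have h5 : h.surplusDrift M H K δ p k t = ∑ x, (M.trans s a x).toReal * v x -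
      ∑ x, (M.trans s a x).toReal * M.value H (p k) (t + 1) x -
      h.surplus M H K δ k (p k) (t + 1) (h.state k (t + 1)) := by
    simp only [surplusDrift, surplus, mul_sub, Finset.sum_sub_distrib, ← hs, ← hadef, ← hv]
  have hcast : (0 : ℝ) ≤ (max (h.visits H k s a) 1 : ℕ) := Nat.cast_nonneg _
  rw [Real.sqrt_div' _ hcast, div_eq_mul_one_div] at h3 h4
  rw [optReward, Real.sqrt_div' _ hcast, div_eq_mul_one_div] at h1
  rw [h5, surplus, h2]
  linarith

/-- The regret of the first `N` episodes of a concentrated greedy trajectory. -/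
theorem sum_optValue_sub_value_le (hH : 1 ≤ H) (hK : 1 ≤ K) (hδ : 0 < δ) (hδ1 : δ < 1)
    (hc : h.Concentrated M H K δ) (hg : h.IsGreedy H K δ p)
    (ha : ∀ k < K, ∀ t < H, h.action k t = p k t (h.state k t)) {N : ℕ} (hN : N ≤ K) :
    ∑ k ∈ Finset.range N, (M.optValue H 0 (h.state k 0) - M.value H (p k) 0 (h.state k 0)) ≤
      Fintype.card S * (H : ℝ) ^ 2 +
      (2 * √(2 * Real.log (8 * Fintype.card S * Fintype.card A * (K * H : ℝ) / δ)) +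
        2 * H * √(4 * Fintype.card S *
          Real.log (12 * Fintype.card S * Fintype.card A * (K * H : ℝ) / δ))) *
        (3 * √(Fintype.card S * Fintype.card A * (N * H : ℝ)) +
          2 * H * Fintype.card S * Fintype.card A) +
      ∑ k ∈ Finset.range N, ∑ t ∈ Finset.range H, h.surplusDrift M H K δ p k t := by
  set B := 2 * √(2 * Real.log (8 * Fintype.card S * Fintype.card A * (K * H : ℝ) / δ)) +
        2 * H * √(4 * Fintype.card S *
          Real.log (12 * Fintype.card S * Fintype.card A * (K * H : ℝ) / δ)) with hB
  have hB0 : 0 ≤ B := by positivity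
  have h1 : ∀ k ∈ Finset.range N,
      M.optValue H 0 (h.state k 0) - M.value H (p k) 0 (h.state k 0) ≤
      ∑ t ∈ Finset.range H,
        ((h.optV H K δ k t (h.state k t) - h.optV H K δ (k + 1) t (h.state k t)) +
          B * (1 / √(max (h.visits H k (h.state k t) (h.action k t)) 1 : ℕ)) +
          h.surplusDrift M H K δ p k t) := by
    intro k hk
    have hk' : k < K := (Finset.mem_range.1 hk).trans_le hN
    have : Nonempty (ℕ → S → A) := ⟨p k⟩
    have e1 : M.optValue H 0 (h.state k 0) ≤ h.optV H K δ k 0 (h.state k 0) :=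
      ciSup_le fun π => value_le_optV hc hg ha hk'.le π 0 _
    -- The surplus vanishes at time-step `H`, so the telescoping sum is the full initial surplus.
    have e2 := Finset.sum_range_sub' (fun t => h.surplus M H K δ k (p k) t (h.state k t)) H
    rw [surplus_of_le le_rfl, sub_zero] at e2
    calc _ ≤ h.surplus M H K δ k (p k) 0 (h.state k 0) := by rw [surplus]; linarith
      _ = _ := e2.symm
      _ ≤ _ := Finset.sum_le_sum fun t ht => by
        have := surplus_le hH hK hδ hδ1 hc ha hk' (Finset.mem_range.1 ht)
        rw [← hB] at this
        linarith
  refine (Finset.sum_le_sum h1).trans ?_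
  simp only [Finset.sum_add_distrib, ← Finset.mul_sum]
  have := h.sum_optV_sub_le H K δ N
  have := mul_le_mul_of_nonneg_left (h.sum_inv_sqrt_visits_le H N) hB0
  simp only [Finset.sum_add_distrib, ← Finset.mul_sum] at *
  linarith

end Trajectory

/-! ### Conditional laws and conditionally centred variables -/

section CondExp

variable {Ω : Type*} {m mΩ : MeasurableSpace Ω} {μ : Measure Ω}

/-- If `R` has the conditional law `ν` on the event `G`, then the integral over `G` of a function
of `R` is the one given by `ν`. -/
theorem setIntegral_comp_of_condProb_eq [IsFiniteMeasure μ] {E : Type*} [MeasurableSpace E]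
    (hm : m ≤ mΩ) {R : Ω → E} (hR : Measurable R) {ν : Measure E} [IsFiniteMeasure ν] {G : Set Ω}
    (hG : MeasurableSet[m] G)
    (h : ∀ B, MeasurableSet B → ∀ᵐ ω ∂μ, ω ∈ G → (μ⟦{ω | R ω ∈ B} | m⟧) ω = ν.real B)
    {f : E → ℝ} (hf : Measurable f) :
    ∫ ω in G, f (R ω) ∂μ = μ.real G * ∫ x, f x ∂ν := by
  -- Identifying the whole pushforward measure handles all measurable `f` at once.
  have hmap : (μ.restrict G).map R = μ G • ν := by
    ext B hB
    rw [Measure.map_apply hR hB, Measure.restrict_apply (hR hB), Measure.smul_apply, smul_eq_mul]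
    have h1 : μ.real (R ⁻¹' B ∩ G) = μ.real G * ν.real B := by
      have e1 : ∫ ω in G, (R ⁻¹' B).indicator (fun _ => (1 : ℝ)) ω ∂μ = μ.real (R ⁻¹' B ∩ G) := by
        rw [integral_indicator (hR hB), Measure.restrict_restrict (hR hB)]
        simp
      have e2 : ∫ ω in G, (μ⟦R ⁻¹' B | m⟧) ω ∂μ = ∫ ω in G, ν.real B ∂μ :=
        setIntegral_congr_ae (hm _ hG) (h B hB)
      rw [← e1, ← setIntegral_condExp hm ((integrable_const _).indicator (hR hB)) hG, e2]
      simp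
    rw [← ENNReal.toReal_eq_toReal_iff' (measure_ne_top _ _)
      (ENNReal.mul_ne_top (measure_ne_top _ _) (measure_ne_top _ _)), ENNReal.toReal_mul]
    exact h1
  rw [← integral_map hR.aemeasurable hf.aestronglyMeasurable, hmap, integral_smul_measure,
    smul_eq_mul]
  rfl

/-- For `s` in `m`, the event `s ∩ G` again carries the conditional law `ν`, so the centred integral
over it is zero; this characterizes a vanishing conditional expectation. -/
theorem condExp_indicator_comp_sub_integral [IsFiniteMeasure μ] {E : Type*} [MeasurableSpace E]
    (hm : m ≤ mΩ) {R : Ω → E} (hR : Measurable R) {ν : Measure E} [IsProbabilityMeasure ν]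
    {G : Set Ω} (hG : MeasurableSet[m] G)
    (h : ∀ B, MeasurableSet B → ∀ᵐ ω ∂μ, ω ∈ G → (μ⟦{ω | R ω ∈ B} | m⟧) ω = ν.real B)
    {f : E → ℝ} (hf : Measurable f) (hfi : Integrable (fun ω => f (R ω)) μ) :
    μ[G.indicator (fun ω => f (R ω) - ∫ x, f x ∂ν) | m] =ᵐ[μ] 0 := by
  have hint : Integrable (G.indicator (fun ω => f (R ω) - ∫ x, f x ∂ν)) μ :=
    (hfi.sub (integrable_const _)).indicator (hm _ hG)
  refine (ae_eq_condExp_of_forall_setIntegral_eq hm hint (fun s _ _ => integrableOn_zero)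
    (fun s hs _ => ?_) (stronglyMeasurable_zero.aestronglyMeasurable)).symm
  rw [setIntegral_indicator (hm _ hG), integral_sub hfi.integrableOn (integrable_const _),
    setIntegral_comp_of_condProb_eq hm hR (hs.inter hG)
      (fun B hB => (h B hB).mono fun ω hω hω' => hω hω'.2) hf]
  simp

/-- If `Z` takes finitely many values and has the conditional law `p`, then `g Z - ∑ p g` is
conditionally centered, for a random function `g` that is known beforehand. -/
theorem condExp_apply_sub_sum [IsFiniteMeasure μ] {S : Type*} [Fintype S] [MeasurableSpace S]
    [DiscreteMeasurableSpace S] (hm : m ≤ mΩ) {Z : Ω → S} (hZ : Measurable Z) {p g : Ω → S → ℝ}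
    (hp : ∀ x, Measurable[m] fun ω => p ω x) (hpi : ∀ x, Integrable (fun ω => p ω x) μ)
    (h : ∀ x, μ⟦{ω | Z ω = x} | m⟧ =ᵐ[μ] fun ω => p ω x)
    (hg : ∀ x, Measurable[m] fun ω => g ω x) {C : ℝ} (hC : ∀ ω x, |g ω x| ≤ C) :
    μ[fun ω => g ω (Z ω) - ∑ x, p ω x * g ω x | m] =ᵐ[μ] 0 := by
  classical
  have hZx : ∀ x, MeasurableSet {ω | Z ω = x} := fun x => hZ (MeasurableSet.of_discrete (s := {x}))
  set J : S → Ω → ℝ := fun x => {ω | Z ω = x}.indicator (fun _ => (1 : ℝ)) with hJ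
  have hJi : ∀ x, Integrable (J x) μ := fun x => (integrable_const _).indicator (hZx x)
  -- A finite sum of known factors times centred indicators, so the known factors can be pulled out
  -- term by term.
  have e : (fun ω => g ω (Z ω) - ∑ x, p ω x * g ω x) =
      ∑ x, (fun ω => g ω x) * (J x - fun ω => p ω x) := by
    ext ω
    simp only [Finset.sum_apply, Pi.mul_apply, Pi.sub_apply, mul_sub, Finset.sum_sub_distrib]
    congr 1
    · rw [Finset.sum_eq_single (Z ω)]
      · simp [hJ]
      · intro x _ hx
        simp [hJ, hx.symm]
      · simp
    · exact Finset.sum_congr rfl fun x _ => mul_comm _ _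
  have hi : ∀ x, Integrable ((fun ω => g ω x) * (J x - fun ω => p ω x)) μ := fun x =>
    ((hJi x).sub (hpi x)).bdd_mul ((hg x).mono hm le_rfl).aestronglyMeasurable
      (Filter.Eventually.of_forall fun ω => hC ω x)
  have h0 : ∀ x, μ[(fun ω => g ω x) * (J x - fun ω => p ω x) | m] =ᵐ[μ] 0 := by
    intro x
    filter_upwards [condExp_mul_of_stronglyMeasurable_left (hg x).stronglyMeasurable (hi x)
      ((hJi x).sub (hpi x)), condExp_sub (hJi x) (hpi x) m, h x] with ω h1 h2 h3
    rw [h1, Pi.mul_apply, h2, Pi.sub_apply,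
      condExp_of_stronglyMeasurable hm (hp x).stronglyMeasurable (hpi x)]
    simp only [hJ, h3, sub_self, mul_zero, Pi.zero_apply]
  rw [e]
  have h0' : ∀ᵐ ω ∂μ, ∀ x, (μ[(fun ω => g ω x) * (J x - fun ω => p ω x) | m]) ω = 0 :=
    ae_all_iff.2 fun x => h0 x
  filter_upwards [condExp_finsetSum (s := Finset.univ) (fun x _ => hi x) m, h0'] with ω h1 h2
  rw [h1, Finset.sum_apply]
  simp [h2]

end CondExp

/-! ### From episodes to a single time index -/

section Episodes

/-- An episode occupies `H + 1` filtration indices but has only `H` transitions. The last slot,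
between the final observation and the next initial state, contributes nothing. -/
theorem sum_range_mul_succ_eq {E : Type*} [AddCommMonoid E] (f : ℕ → ℕ → E) (H N : ℕ) :
    ∑ i ∈ Finset.range (N * (H + 1)),
      (if i % (H + 1) < H then f (i / (H + 1)) (i % (H + 1)) else 0) =
      ∑ k ∈ Finset.range N, ∑ t ∈ Finset.range H, f k t := by
  induction N with
  | zero => simp
  | succ N ih =>
    rw [Nat.succ_mul, Finset.sum_range_add, ih, Finset.sum_range_succ (fun k => _) N]
    congr 1
    rw [Finset.sum_range_succ]
    have h1 : ∀ t < H + 1, (N * (H + 1) + t) % (H + 1) = t := fun t ht => by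
      rw [mul_comm, Nat.mul_add_mod, Nat.mod_eq_of_lt ht]
    have h2 : ∀ t < H + 1, (N * (H + 1) + t) / (H + 1) = N := fun t ht => by
      rw [mul_comm, Nat.mul_add_div H.succ_pos, Nat.div_eq_of_lt ht, add_zero]
    rw [h1 H H.lt_succ_self, if_neg (lt_irrefl H), add_zero]
    refine Finset.sum_congr rfl fun t ht => ?_
    have ht' := Finset.mem_range.1 ht
    rw [h1 t (by omega), h2 t (by omega), if_pos ht']

variable {Ω : Type*} {mΩ : MeasurableSpace Ω} {μ : Measure Ω}

/-- The Hoeffding inequality for martingale differences indexed by episodes and time-steps. -/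
theorem measureReal_episodic_sum_ge_le_exp [IsProbabilityMeasure μ] {ℱ : Filtration ℕ mΩ}
    {H K : ℕ} {F : ℕ → ℕ → Ω → ℝ} {D : ℕ → ℕ → Set Ω} {a b : ℝ}
    (ha : a ≤ 0) (hb : 0 ≤ b) (hab : a < b)
    (hF : ∀ k < K, ∀ t < H, Measurable[ℱ (k * (H + 1) + (t + 1))] (F k t))
    (hFab : ∀ k < K, ∀ t < H, ∀ ω, F k t ω ∈ Set.Icc a b)
    (hD : ∀ k < K, ∀ t < H, MeasurableSet[ℱ (k * (H + 1) + t)] (D k t))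
    (hFD : ∀ k < K, ∀ t < H, ∀ ω ∉ D k t, F k t ω = 0)
    (hc : ∀ k < K, ∀ t < H, μ[F k t | ℱ (k * (H + 1) + t)] =ᵐ[μ] 0) {N : ℕ} (hN : N ≤ K)
    {x v : ℝ} (hx : 0 ≤ x) (hv : 0 < v) :
    μ.real {ω | x ≤ ∑ k ∈ Finset.range N, ∑ t ∈ Finset.range H, F k t ω ∧
        ∑ k ∈ Finset.range N, ∑ t ∈ Finset.range H, (D k t).indicator (1 : Ω → ℝ) ω ≤ v} ≤
      Real.exp (-(2 * x ^ 2 / (v * (b - a) ^ 2))) := by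
  classical
  -- The slots of genuine transitions in the `K` episodes; every other slot gets a zero increment
  -- and an empty predictable event.
  set P : ℕ → Prop := fun i => i / (H + 1) < K ∧ i % (H + 1) < H with hP
  set Y : ℕ → Ω → ℝ := fun i => if P i then F (i / (H + 1)) (i % (H + 1)) else 0 with hY
  set E : ℕ → Set Ω := fun i => if P i then D (i / (H + 1)) (i % (H + 1)) else ∅ with hE
  have hi : ∀ i, i / (H + 1) * (H + 1) + i % (H + 1) = i := fun i => Nat.div_add_mod' _ _
  have key := measureReal_sum_ge_le_exp (μ := μ) (ℱ := ℱ) (Y := Y) (D := E) ha hb hab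
    (fun i => by
      by_cases h : P i
      · have := hF _ h.1 _ h.2
        rw [← add_assoc, hi] at this
        simpa only [hY, if_pos h] using this
      · simp only [hY, if_neg h]
        exact @measurable_const _ _ _ (ℱ (i + 1)) 0)
    (fun i ω => by
      by_cases h : P i
      · simpa only [hY, if_pos h] using hFab _ h.1 _ h.2 ω
      · simpa only [hY, if_neg h] using ⟨ha, hb⟩)
    (fun i => by
      by_cases h : P i
      · have := hD _ h.1 _ h.2
        rw [hi] at this
        simpa only [hE, if_pos h] using this
      · simp only [hE, if_neg h]
        exact @MeasurableSet.empty _ (ℱ i))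
    (fun i ω hω => by
      by_cases h : P i
      · simp only [hE, if_pos h] at hω
        simpa only [hY, if_pos h] using hFD _ h.1 _ h.2 ω hω
      · simp only [hY, if_neg h, Pi.zero_apply])
    (fun i => by
      by_cases h : P i
      · have := hc _ h.1 _ h.2
        rw [hi] at this
        simpa only [hY, if_pos h] using this
      · simp only [hY, if_neg h, condExp_zero]
        rfl) (N * (H + 1)) hx hv
  refine le_of_eq_of_le ?_ key
  have hdiv : ∀ i ∈ Finset.range (N * (H + 1)), i / (H + 1) < K := fun i hi =>
    (Nat.div_lt_of_lt_mul (by rw [mul_comm]; exact Finset.mem_range.1 hi)).trans_le hN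
  congr 1
  ext ω
  have e1 : ∑ i ∈ Finset.range (N * (H + 1)), Y i ω =
      ∑ k ∈ Finset.range N, ∑ t ∈ Finset.range H, F k t ω := by
    rw [← sum_range_mul_succ_eq (fun k t => F k t ω)]
    refine Finset.sum_congr rfl fun i hi => ?_
    simp only [hY, hP, hdiv i hi, true_and]
    split_ifs <;> rfl
  have e2 : ∑ i ∈ Finset.range (N * (H + 1)), (E i).indicator (1 : Ω → ℝ) ω =
      ∑ k ∈ Finset.range N, ∑ t ∈ Finset.range H, (D k t).indicator (1 : Ω → ℝ) ω := by
    rw [← sum_range_mul_succ_eq (fun k t => (D k t).indicator (1 : Ω → ℝ) ω)]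
    refine Finset.sum_congr rfl fun i hi => ?_
    simp only [hE, hP, hdiv i hi, true_and]
    split_ifs
    · rfl
    · simp
  rw [Set.mem_ofPred_eq, Set.mem_ofPred_eq, e1, e2]

theorem measureReal_le_card_mul {ι : Type*} [IsFiniteMeasure μ] (I : Finset ι) {E : Set Ω}
    {f : ι → Set Ω} (hE : E ⊆ ⋃ i ∈ I, f i) {c : ℝ} (hf : ∀ i ∈ I, μ.real (f i) ≤ c) :
    μ.real E ≤ I.card * c := by
  refine (measureReal_mono hE (measure_ne_top _ _)).trans ((measureReal_biUnion_finset_le I f).trans ?_)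
  simpa using Finset.sum_le_card_nsmul I _ c hf

end Episodes

/-! ### Measurability of the algorithm's quantities -/

section Measurability

theorem Measurable.apply_of_countable {Ω A E : Type*} [MeasurableSpace Ω] [MeasurableSpace E]
    [Countable A] [MeasurableSpace A] [MeasurableSingletonClass A] {G : A → Ω → E} {f : Ω → A}
    (hG : ∀ a, Measurable (G a)) (hf : Measurable f) : Measurable fun ω => G (f ω) ω :=
  (measurable_from_prod_countable_right (f := fun q : A × Ω => G q.1 q.2) hG).comp
    (hf.prodMk measurable_id)

namespace Trajectory

/-- The maximum over a confidence set, as a function of the counts that determine the set and of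
the value vector. -/
theorem measurable_sSup_confSet {S : Type*} [Fintype S] (B : ℕ → ℝ) :
    Measurable fun q : (ℕ × (S → ℕ)) × (S → ℝ) =>
      sSup ((fun P : S → ℝ => ∑ x, P x * q.2 x) ''
        {P | P ∈ stdSimplex ℝ S ∧ ∑ x, |P x - (q.1.2 x : ℝ) / (q.1.1 : ℝ)| ≤ B q.1.1}) := by
  -- The counts range over a countable type, so only continuity in the value vector is needed; it
  -- follows from compactness of the confidence set.
  refine measurable_from_prod_countable_right fun c => Continuous.measurable ?_
  have hK : IsCompact {P : S → ℝ | P ∈ stdSimplex ℝ S ∧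
      ∑ x, |P x - (c.2 x : ℝ) / (c.1 : ℝ)| ≤ B c.1} :=
    (isCompact_stdSimplex ℝ S).inter_right (isClosed_le (f := fun P : S → ℝ =>
      ∑ x, |P x - (c.2 x : ℝ) / (c.1 : ℝ)|) (by fun_prop) continuous_const)
  have hf : Continuous ↿fun (v P : S → ℝ) => ∑ x, P x * v x := by
    simp only [Function.HasUncurry.uncurry, id]
    fun_prop
  exact hK.continuous_sSup hf

variable {S A Ω : Type*} [MeasurableSpace S] [MeasurableSpace A] [MeasurableSpace Ω]
  {H k : ℕ} {X : Ω → Trajectory S A}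

theorem measurableSet_visit [DiscreteMeasurableSpace S] [DiscreteMeasurableSpace A] {t : ℕ}
    (hs : Measurable fun ω => (X ω).state k t) (ha : Measurable fun ω => (X ω).action k t)
    (s : S) (a : A) : MeasurableSet {ω | (X ω).state k t = s ∧ (X ω).action k t = a} :=
  (hs (MeasurableSet.of_discrete (s := {s}))).inter (ha (MeasurableSet.of_discrete (s := {a})))

variable [DecidableEq S] [DecidableEq A]

theorem measurable_sum_visitTimes [DiscreteMeasurableSpace S] [DiscreteMeasurableSpace A]
    {E : Type*} [AddCommMonoid E] [MeasurableSpace E] [MeasurableAdd₂ E]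
    (hs : ∀ j < k, ∀ t < H, Measurable fun ω => (X ω).state j t)
    (ha : ∀ j < k, ∀ t < H, Measurable fun ω => (X ω).action j t)
    {f : Ω → ℕ × ℕ → E} (hf : ∀ j < k, ∀ t < H, Measurable fun ω => f ω (j, t)) (s : S) (a : A) :
    Measurable fun ω => ∑ q ∈ (X ω).visitTimes H k s a, f ω q := by
  simp only [sum_visitTimes]
  refine Finset.measurable_sum _ fun j hj => Finset.measurable_sum _ fun t ht => ?_
  rw [Finset.mem_range] at hj ht
  exact Measurable.ite (measurableSet_visit (hs j hj t ht) (ha j hj t ht) s a) (hf j hj t ht)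
    measurable_const

variable [Fintype S] [Fintype A] {K : ℕ} {δ : ℝ}

theorem measurable_optQ [DiscreteMeasurableSpace S] [DiscreteMeasurableSpace A]
    (hs : ∀ j < k, ∀ t ≤ H, Measurable fun ω => (X ω).state j t)
    (ha : ∀ j < k, ∀ t < H, Measurable fun ω => (X ω).action j t)
    (hr : ∀ j < k, ∀ t < H, Measurable fun ω => (X ω).reward j t)
    {v : Ω → S → ℝ} (hv : ∀ x, Measurable fun ω => v ω x) (s : S) (a : A) :
    Measurable fun ω => (X ω).optQ H K δ k s a (v ω) := by
  have hs' := fun j hj t (ht : t < H) => hs j hj t ht.le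
  have hn : Measurable fun ω => (X ω).visits H k s a := by
    simp only [visits, Finset.card_eq_sum_ones]
    exact measurable_sum_visitTimes hs' ha (fun _ _ _ _ => measurable_const) s a
  have hcount : ∀ x, Measurable fun ω =>
      (((X ω).visitTimes H k s a).filter fun q => (X ω).state q.1 (q.2 + 1) = x).card := fun x => by
    simp only [Finset.card_filter]
    refine measurable_sum_visitTimes (f := fun ω q =>
      if (X ω).state q.1 (q.2 + 1) = x then 1 else 0) hs' ha (fun j hj t ht => ?_) s a
    exact Measurable.ite (hs j hj (t + 1) ht (MeasurableSet.of_discrete (s := {x})))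
      measurable_const measurable_const
  have hcast : ∀ f : ℕ → ℝ, Measurable f := fun f => measurable_from_nat
  unfold optQ
  refine Measurable.add ?_ ?_
  · have h1 : Measurable fun ω =>
        (∑ q ∈ (X ω).visitTimes H k s a, ((X ω).reward q.1 q.2 : ℝ)) :=
      measurable_sum_visitTimes hs' ha
        (fun j hj t ht => measurable_subtype_coe.comp (hr j hj t ht)) s a
    have h2 : Measurable fun ω => ((X ω).visits H k s a : ℝ) := (hcast Nat.cast).comp hn
    have h3 : Measurable fun ω =>
        √(2 * Real.log (8 * Fintype.card S * Fintype.card A * (K * H : ℝ) / δ) /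
          (max ((X ω).visits H k s a) 1 : ℕ)) :=
      (hcast fun n => √(2 * Real.log (8 * Fintype.card S * Fintype.card A * (K * H : ℝ) / δ) /
        (max n 1 : ℕ))).comp hn
    exact (h1.div h2).add h3
  · have h1 := measurable_sSup_confSet (S := S) fun n => √(4 * Fintype.card S *
          Real.log (12 * Fintype.card S * Fintype.card A * (K * H : ℝ) / δ) / (max n 1 : ℕ))
    have h2 := (hn.prodMk (measurable_pi_lambda _ hcount)).prodMk (measurable_pi_lambda v hv)
    have e : ∀ ω, (X ω).confSet H K δ k s a = {P | P ∈ stdSimplex ℝ S ∧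
        ∑ x, |P x - ((((X ω).visitTimes H k s a).filter
          fun q => (X ω).state q.1 (q.2 + 1) = x).card : ℝ) / ((X ω).visits H k s a : ℝ)| ≤
        √(4 * Fintype.card S *
          Real.log (12 * Fintype.card S * Fintype.card A * (K * H : ℝ) / δ) /
            (max ((X ω).visits H k s a) 1 : ℕ))} := fun ω => rfl
    simp only [e]
    have h3 := h1.comp h2
    simp only [Function.comp_def] at h3
    exact h3

theorem measurable_optV [DiscreteMeasurableSpace S] [DiscreteMeasurableSpace A]
    (hs : ∀ j < k, ∀ t ≤ H, Measurable fun ω => (X ω).state j t)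
    (ha : ∀ j < k, ∀ t < H, Measurable fun ω => (X ω).action j t)
    (hr : ∀ j < k, ∀ t < H, Measurable fun ω => (X ω).reward j t) (t : ℕ) (s : S) :
    Measurable fun ω => (X ω).optV H K δ k t s := by
  induction k generalizing t s with
  | zero => exact measurable_const
  | succ k ih =>
    have ih' := ih (fun j hj => hs j (hj.trans k.lt_succ_self))
      (fun j hj => ha j (hj.trans k.lt_succ_self)) (fun j hj => hr j (hj.trans k.lt_succ_self))
    simp only [optV]
    by_cases ht : t < H
    · simp only [ht, true_and]
      refine Measurable.ite ?_ (Measurable.min (ih' t s) ?_) (ih' t s)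
      · have := hs k k.lt_succ_self t ht.le (MeasurableSet.of_discrete (s := {s}))
        simpa only [Set.preimage, Set.mem_singleton_iff, eq_comm] using this
      · exact Measurable.apply_of_countable
          (G := fun a ω => (X ω).optQ H K δ k s a ((X ω).optV H K δ k (t + 1)))
          (fun a => measurable_optQ (fun j hj => hs j (hj.trans k.lt_succ_self))
            (fun j hj => ha j (hj.trans k.lt_succ_self))
            (fun j hj => hr j (hj.trans k.lt_succ_self)) (ih' (t + 1)) s a)
          (ha k k.lt_succ_self t ht)
    · simpa only [ht, false_and, if_false] using ih' t s

end Trajectory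

/-- Recursion through the Bellman equation: the random policy enters only through its single
actions, each in a discrete space, so the space of policies needs no measurable structure. -/
theorem FiniteMDP.measurable_value {S A Ω : Type*} [Fintype S] [MeasurableSpace A]
    [DiscreteMeasurableSpace A] [MeasurableSpace Ω] (M : FiniteMDP S A) {H : ℕ}
    {π : Ω → ℕ → S → A} (hπ : ∀ t < H, ∀ s, Measurable fun ω => π ω t s) (t : ℕ) (s : S) :
    Measurable fun ω => M.value H (π ω) t s := by
  rcases le_or_gt H t with ht | ht
  · simp only [M.value_of_le H _ ht]
    exact measurable_const
  · simp only [M.value_eq_add H _ ht]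
    have h0 : ∀ f : A → ℝ, Measurable fun ω => f (π ω t s) := fun f =>
      (Measurable.of_discrete (f := f)).comp (hπ t ht s)
    exact (h0 _).add (Finset.measurable_sum _ fun x _ =>
      (h0 fun a => (M.trans s a x).toReal).mul (M.measurable_value hπ (t + 1) x))
termination_by H - t

end Measurability

/-! ### Adaptedness of the interaction -/

namespace EpisodicInteraction

variable {S A Ω : Type*} [MeasurableSpace S] [DiscreteMeasurableSpace S] [MeasurableSpace A]
  {mΩ : MeasurableSpace Ω} {μ : Measure Ω} {M : FiniteMDP S A} {H K : ℕ} {δ : ℝ}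
  {ℱ : Filtration ℕ mΩ} {X : Ω → Trajectory S A} {π : ℕ → Ω → ℕ → S → A}

theorem mul_succ_add_le {j k t u H : ℕ} (hjk : j < k) (hu : u ≤ H) :
    j * (H + 1) + u ≤ k * (H + 1) + t := by
  have := Nat.mul_le_mul_right (H + 1) (Nat.succ_le_of_lt hjk)
  rw [Nat.succ_mul] at this
  omega

variable (I : EpisodicInteraction M H K μ ℱ X π)
include I

theorem measurable_state_succ {k t : ℕ} (hk : k < K) (ht : t < H) (f : S → ℝ) :
    Measurable[ℱ (k * (H + 1) + (t + 1))] fun ω => f ((X ω).state k (t + 1)) :=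
  (Measurable.of_discrete (f := f)).comp (I.measurable_state k hk (t + 1) ht)

variable [Fintype S]

theorem measurable_action {k t : ℕ} (hk : k < K) (ht : t < H) :
    Measurable[ℱ (k * (H + 1) + t)] fun ω => (X ω).action k t := by
  simp only [I.action_eq k hk t ht]
  exact @Measurable.apply_of_countable _ _ _ (ℱ (k * (H + 1) + t)) _ _ _ _
    (fun s ω => π k ω t s) _ (fun s => (I.measurable_policy k hk t ht s).mono
      (ℱ.mono (Nat.le_add_right _ _)) le_rfl) (I.measurable_state k hk t ht.le)

variable [DiscreteMeasurableSpace A]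

theorem measurable_comp_visit {k t : ℕ} (hk : k < K) (ht : t < H) (f : S → A → ℝ) :
    Measurable[ℱ (k * (H + 1) + t)] fun ω => f ((X ω).state k t) ((X ω).action k t) :=
  @Measurable.apply_of_countable _ _ _ (ℱ (k * (H + 1) + t)) _ _ _ _
    (fun s ω => f s ((X ω).action k t)) _
    (fun s => (Measurable.of_discrete (f := f s)).comp (I.measurable_action hk ht))
    (I.measurable_state k hk t ht.le)

theorem measurableSet_visit {k t : ℕ} (hk : k < K) (ht : t < H) (s : S) (a : A) :
    MeasurableSet[ℱ (k * (H + 1) + t)] {ω | (X ω).state k t = s ∧ (X ω).action k t = a} :=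
  @Trajectory.measurableSet_visit S A Ω _ _ (ℱ (k * (H + 1) + t)) k X _ _ t
    (I.measurable_state k hk t ht.le) (I.measurable_action hk ht) s a

theorem condExp_sub_sum_trans [IsProbabilityMeasure μ] {k t : ℕ} (hk : k < K) (ht : t < H) {g : Ω → S → ℝ}
    (hg : ∀ x, Measurable[ℱ (k * (H + 1) + t)] fun ω => g ω x) {C : ℝ}
    (hC : ∀ ω x, |g ω x| ≤ C) :
    μ[fun ω => g ω ((X ω).state k (t + 1)) -
      ∑ x, (M.trans ((X ω).state k t) ((X ω).action k t) x).toReal * g ω x |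
        ℱ (k * (H + 1) + t)] =ᵐ[μ] 0 := by
  have hp : ∀ x, Measurable[ℱ (k * (H + 1) + t)] fun ω =>
      (M.trans ((X ω).state k t) ((X ω).action k t) x).toReal := fun x =>
    I.measurable_comp_visit hk ht fun s a => (M.trans s a x).toReal
  refine condExp_apply_sub_sum (ℱ.le _)
    ((I.measurable_state k hk (t + 1) ht).mono (ℱ.le _) le_rfl) hp (fun x => ?_)
    (fun x => I.trans_law k hk t ht x) hg hC
  refine Integrable.of_bound ((hp x).mono (ℱ.le _) le_rfl).aestronglyMeasurable 1
    (Filter.Eventually.of_forall fun ω => ?_)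
  rw [Real.norm_of_nonneg ENNReal.toReal_nonneg]
  exact ENNReal.toReal_le_of_le_ofReal zero_le_one (by simpa using PMF.coe_le_one _ _)

/-- Both the optimistic values and the policy are fixed before episode `k` begins. This is what
makes the drift a martingale difference at every step of the episode. -/
theorem measurable_surplus [Fintype A] [DecidableEq S] [DecidableEq A] {k : ℕ}
    (hk : k < K) (t : ℕ) (x : S) :
    Measurable[ℱ (k * (H + 1))] fun ω => (X ω).surplus M H K δ k (π k ω) t x := by
  have h1 : Measurable[ℱ (k * (H + 1))] fun ω => (X ω).optV H K δ k t x :=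
    @Trajectory.measurable_optV S A Ω _ _ (ℱ (k * (H + 1))) H k X _ _ _ _ K δ _ _
      (fun j hj u hu => (I.measurable_state j (hj.trans hk) u hu).mono
        (ℱ.mono (mul_succ_add_le (t := 0) hj hu)) le_rfl)
      (fun j hj u hu => (I.measurable_action (hj.trans hk) hu).mono
        (ℱ.mono (mul_succ_add_le (t := 0) hj hu.le)) le_rfl)
      (fun j hj u hu => (I.measurable_reward j (hj.trans hk) u hu).mono
        (ℱ.mono (mul_succ_add_le (t := 0) hj hu)) le_rfl) t x
  have h2 : Measurable[ℱ (k * (H + 1))] fun ω => M.value H (π k ω) t x :=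
    @FiniteMDP.measurable_value S A Ω _ _ _ (ℱ (k * (H + 1))) M H _
      (fun u hu s => I.measurable_policy k hk u hu s) t x
  exact Measurable.fun_sub h1 h2

end EpisodicInteraction

/-! ### Deviation inequalities for empirical means and for the drift -/

theorem Trajectory.sum_ite_visit {S A : Type*} [DecidableEq S] [DecidableEq A] (H : ℕ)
    (h : Trajectory S A) (N : ℕ) (s : S) (a : A) (f : ℕ → ℕ → ℝ) :
    ∑ k ∈ Finset.range N, ∑ t ∈ Finset.range H,
      (if h.state k t = s ∧ h.action k t = a then f k t else 0) =
      ∑ q ∈ h.visitTimes H N s a, f q.1 q.2 := by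
  rw [h.sum_visitTimes H (fun q => f q.1 q.2)]

namespace EpisodicInteraction

variable {S A Ω : Type*} [Fintype S] [DecidableEq S] [DecidableEq A]
  [MeasurableSpace S] [DiscreteMeasurableSpace S] [MeasurableSpace A] [DiscreteMeasurableSpace A]
  {mΩ : MeasurableSpace Ω} {μ : Measure Ω} [IsProbabilityMeasure μ]
  {M : FiniteMDP S A} {H K : ℕ} {δ : ℝ}
  {ℱ : Filtration ℕ mΩ} {X : Ω → Trajectory S A} {π : ℕ → Ω → ℕ → S → A}

variable (I : EpisodicInteraction M H K μ ℱ X π)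
include I

/-- Centred rewards supported on the visits to the pair are martingale differences of range `1`.
With exactly `n` visits they sum to `n` times the deviation and the support count is `n`, so neither
independence nor stopping times are needed. `σ` selects the tail. -/
theorem measureReal_empReward_sub_ge_le {N : ℕ} (hN : N ≤ K) (s : S) (a : A) (σ : Bool) {n : ℕ}
    (hn : 0 < n) {ε : ℝ} (hε : 0 ≤ ε) :
    μ.real {ω | (X ω).visits H N s a = n ∧
        ε ≤ (if σ then 1 else -1) * ((X ω).empReward H N s a - M.meanReward s a)} ≤
      Real.exp (-(2 * n * ε ^ 2)) := by
  set D : ℕ → ℕ → Set Ω := fun k t => {ω | (X ω).state k t = s ∧ (X ω).action k t = a} with hD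
  set c : ℝ := if σ then 1 else -1 with hc
  set r := M.meanReward s a with hr
  have hr01 := M.meanReward_mem_Icc s a
  rw [← hr] at hr01
  set F : ℕ → ℕ → Ω → ℝ := fun k t => (D k t).indicator
    (fun ω => c * ((X ω).reward k t : ℝ) - c * r) with hF
  have hn' : (0 : ℝ) < n := by exact_mod_cast hn
  have hlo : ∀ x ∈ Set.Icc (0 : ℝ) 1, c * x - c * r ∈
      Set.Icc (if σ then -r else r - 1) (if σ then 1 - r else r) := by
    rintro x ⟨h0, h1⟩
    cases σ <;> simp [hc] <;> constructor <;> linarith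
  have hlo' : (if σ then -r else r - 1) ≤ 0 := by split_ifs <;> linarith [hr01.1, hr01.2]
  have hhi' : 0 ≤ (if σ then 1 - r else r) := by split_ifs <;> linarith [hr01.1, hr01.2]
  have hw : (if σ then 1 - r else r) - (if σ then -r else r - 1) = 1 := by split_ifs <;> ring
  have key := measureReal_episodic_sum_ge_le_exp (μ := μ) (ℱ := ℱ) (F := F) (D := D)
    (K := K) (H := H) hlo' hhi' (by linarith) (fun k hk t ht => by
      have h1 : Measurable[ℱ (k * (H + 1) + (t + 1))] fun ω =>
          c * ((X ω).reward k t : ℝ) - c * r :=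
        (show Measurable fun x : unitInterval => c * (x : ℝ) - c * r by fun_prop).comp
          (I.measurable_reward k hk t ht)
      exact h1.indicator (ℱ.mono (by omega) _ (I.measurableSet_visit hk ht s a)))
    (fun k hk t ht ω => by
      by_cases hω : ω ∈ D k t
      · simp only [hF, Set.indicator_of_mem hω]
        exact hlo _ ((X ω).reward k t).2
      · simp only [hF, Set.indicator_of_notMem hω]
        exact ⟨hlo', hhi'⟩)
    (fun k hk t ht => I.measurableSet_visit hk ht s a)
    (fun k hk t ht ω hω => Set.indicator_of_notMem hω _)
    (fun k hk t ht => by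
      have hmeas := (I.measurable_reward k hk t ht).mono (ℱ.le _) le_rfl
      have h1 := condExp_indicator_comp_sub_integral (μ := μ) (ℱ.le (k * (H + 1) + t)) hmeas
        (ν := (M.reward s a : Measure unitInterval)) (I.measurableSet_visit hk ht s a)
        (fun B hB => by
          filter_upwards [I.reward_law k hk t ht B hB] with ω hω hωD
          rw [hω, hωD.1, hωD.2]) (f := fun x => c * (x : ℝ)) (by fun_prop)
        (Integrable.of_bound
          ((show Measurable fun x : unitInterval => c * (x : ℝ) by fun_prop).comp
            hmeas).aestronglyMeasurable |c| (Filter.Eventually.of_forall fun ω => by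
              simp only [norm_mul, Real.norm_eq_abs]
              rw [abs_of_nonneg ((X ω).reward k t).2.1]
              exact mul_le_of_le_one_right (abs_nonneg _) ((X ω).reward k t).2.2))
      rw [integral_const_mul] at h1
      exact h1) hN (x := n * ε) (v := n) (by positivity) hn'
  rw [hw] at key
  refine (measureReal_mono ?_ (measure_ne_top _ _)).trans (key.trans (Real.exp_le_exp.2 ?_))
  · rintro ω ⟨hω1, hω2⟩
    have e1 : ∑ k ∈ Finset.range N, ∑ t ∈ Finset.range H, F k t ω =
        n * (c * ((X ω).empReward H N s a - r)) := by
      simp only [hF, hD, Set.indicator_apply, Set.mem_ofPred_eq]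
      rw [(X ω).sum_ite_visit H N s a fun k t => c * ((X ω).reward k t : ℝ) - c * r,
        Finset.sum_sub_distrib, ← Finset.mul_sum, Finset.sum_const, nsmul_eq_mul,
        show ((X ω).visitTimes H N s a).card = n from hω1, Trajectory.empReward, hω1]
      field_simp
    have e2 : ∑ k ∈ Finset.range N, ∑ t ∈ Finset.range H, (D k t).indicator (1 : Ω → ℝ) ω = n := by
      simp only [hD, Set.indicator_apply, Set.mem_ofPred_eq, Pi.one_apply]
      rw [(X ω).sum_ite_visit H N s a fun _ _ => 1, Finset.sum_const, nsmul_eq_mul, mul_one,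
        show ((X ω).visitTimes H N s a).card = n from hω1]
    rw [Set.mem_ofPred_eq, e1, e2]
    exact ⟨mul_le_mul_of_nonneg_left hω2 hn'.le, le_rfl⟩
  · refine neg_le_neg (le_of_eq ?_)
    field_simp

/-- The test vector `f` turns the transition error into a scalar martingale; sign vectors will later
recover the `L¹` norm. The increments have range `2`, which changes the exponent from `2 n ε ^ 2` to
`n ε ^ 2 / 2`. -/
theorem measureReal_empTrans_sub_ge_le {N : ℕ} (hN : N ≤ K) (s : S) (a : A) {f : S → ℝ}
    (hf : ∀ x, |f x| ≤ 1) {n : ℕ} (hn : 0 < n) {ε : ℝ} (hε : 0 ≤ ε) :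
    μ.real {ω | (X ω).visits H N s a = n ∧
        ε ≤ ∑ x, f x * ((X ω).empTrans H N s a x - (M.trans s a x).toReal)} ≤
      Real.exp (-(n * ε ^ 2 / 2)) := by
  set D : ℕ → ℕ → Set Ω := fun k t => {ω | (X ω).state k t = s ∧ (X ω).action k t = a} with hD
  set r := ∑ x, (M.trans s a x).toReal * f x with hr
  have hr1 : |r| ≤ 1 := by
    refine (Finset.abs_sum_le_sum_abs _ _).trans ?_
    rw [← (M.trans s a).sum_toReal_eq_one]
    refine Finset.sum_le_sum fun x _ => ?_
    rw [abs_mul, abs_of_nonneg ENNReal.toReal_nonneg]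
    exact mul_le_of_le_one_right ENNReal.toReal_nonneg (hf x)
  rw [abs_le] at hr1
  set F : ℕ → ℕ → Ω → ℝ := fun k t => (D k t).indicator
    (fun ω => f ((X ω).state k (t + 1)) - r) with hF
  have hn' : (0 : ℝ) < n := by exact_mod_cast hn
  have key := measureReal_episodic_sum_ge_le_exp (μ := μ) (ℱ := ℱ) (F := F) (D := D)
    (K := K) (H := H) (a := -1 - r) (b := 1 - r) (by linarith) (by linarith) (by linarith)
    (fun k hk t ht =>
      (Measurable.sub_const (I.measurable_state_succ hk ht f) r :).indicator
        (ℱ.mono (by omega) _ (I.measurableSet_visit hk ht s a)))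
    (fun k hk t ht ω => by
      by_cases hω : ω ∈ D k t
      · simp only [hF, Set.indicator_of_mem hω]
        have := abs_le.1 (hf ((X ω).state k (t + 1)))
        constructor <;> linarith
      · simp only [hF, Set.indicator_of_notMem hω]
        constructor <;> linarith)
    (fun k hk t ht => I.measurableSet_visit hk ht s a)
    (fun k hk t ht ω hω => Set.indicator_of_notMem hω _)
    (fun k hk t ht => by
      -- The visit is known before the transition, so its indicator may be part of `g`; on it the
      -- random kernel is the kernel of `(s, a)`.
      have h1 := I.condExp_sub_sum_trans hk ht (g := fun ω x => (D k t).indicator (fun _ => f x) ω)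
        (C := 1) (fun x => (@measurable_const _ _ _ (ℱ (k * (H + 1) + t)) (f x)).indicator
          (I.measurableSet_visit hk ht s a))
        (fun ω x => by
          by_cases hω : ω ∈ D k t
          · simpa only [Set.indicator_of_mem hω] using hf x
          · simp [Set.indicator_of_notMem hω])
      convert h1 using 2
      ext ω
      by_cases hω : ω ∈ D k t
      · simp only [hF, Set.indicator_of_mem hω, hr]
        rw [hω.1, hω.2]
      · simp [hF, Set.indicator_of_notMem hω]) hN (x := n * ε) (v := n) (by positivity) hn'
  refine (measureReal_mono ?_ (measure_ne_top _ _)).trans (key.trans (Real.exp_le_exp.2 ?_))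
  · rintro ω ⟨hω1, hω2⟩
    have e1 : ∑ k ∈ Finset.range N, ∑ t ∈ Finset.range H, F k t ω =
        n * ∑ x, f x * ((X ω).empTrans H N s a x - (M.trans s a x).toReal) := by
      simp only [hF, hD, Set.indicator_apply, Set.mem_ofPred_eq]
      rw [(X ω).sum_ite_visit H N s a fun k t => f ((X ω).state k (t + 1)) - r,
        Finset.sum_sub_distrib, Finset.sum_const, nsmul_eq_mul,
        show ((X ω).visitTimes H N s a).card = n from hω1]
      simp only [mul_sub, Finset.sum_sub_distrib]
      congr 1
      · simp only [Trajectory.empTrans, hω1, Finset.mul_sum]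
        rw [← Finset.sum_fiberwise _ fun q : ℕ × ℕ => (X ω).state q.1 (q.2 + 1)]
        refine Finset.sum_congr rfl fun x _ => ?_
        rw [Finset.sum_congr rfl (g := fun _ => f x)
          fun q hq => by rw [(Finset.mem_filter.1 hq).2], Finset.sum_const, nsmul_eq_mul]
        field_simp
      · rw [hr]
        congr 1
        exact Finset.sum_congr rfl fun x _ => mul_comm _ _
    have e2 : ∑ k ∈ Finset.range N, ∑ t ∈ Finset.range H, (D k t).indicator (1 : Ω → ℝ) ω = n := by
      simp only [hD, Set.indicator_apply, Set.mem_ofPred_eq, Pi.one_apply]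
      rw [(X ω).sum_ite_visit H N s a fun _ _ => 1, Finset.sum_const, nsmul_eq_mul, mul_one,
        show ((X ω).visitTimes H N s a).card = n from hω1]
    rw [Set.mem_ofPred_eq, e1, e2]
    exact ⟨mul_le_mul_of_nonneg_left hω2 hn'.le, le_rfl⟩
  · refine neg_le_neg (le_of_eq ?_)
    field_simp
    ring

/-- The Azuma--Hoeffding inequality for the drift of the optimistic surplus. -/
theorem measureReal_sum_surplusDrift_ge_le [Fintype A] {N : ℕ} (hN : N ≤ K) (hN0 : 0 < N) (hH : 0 < H)
    {x : ℝ} (hx : 0 ≤ x) :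
    μ.real {ω | x ≤ ∑ k ∈ Finset.range N, ∑ t ∈ Finset.range H,
        (X ω).surplusDrift M H K δ (fun k => π k ω) k t} ≤
      Real.exp (-(x ^ 2 / (8 * N * (H : ℝ) ^ 3))) := by
  have hH' : (0 : ℝ) < H := by exact_mod_cast hH
  have hN' : (0 : ℝ) < N := by exact_mod_cast hN0
  set g : ℕ → ℕ → Ω → S → ℝ := fun k t ω x =>
    -(X ω).surplus M H K δ k (π k ω) (t + 1) x with hg
  have hgm : ∀ k < K, ∀ t < H, ∀ x, Measurable[ℱ (k * (H + 1) + t)] fun ω => g k t ω x :=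
    fun k hk t ht x => (Measurable.fun_neg (I.measurable_surplus hk (t + 1) x) :).mono
      (ℱ.mono (Nat.le_add_right _ _)) le_rfl
  have hgC : ∀ k t ω x, |g k t ω x| ≤ H := fun k t ω x => by
    have := Trajectory.surplus_mem_Icc (M := M) (K := K) (δ := δ) (h := X ω) (H := H) k (π k ω)
      (t + 1) x
    rw [abs_le]
    simp only [hg]
    constructor <;> linarith [this.1, this.2]
  set F : ℕ → ℕ → Ω → ℝ := fun k t ω => g k t ω ((X ω).state k (t + 1)) -
      ∑ x, (M.trans ((X ω).state k t) ((X ω).action k t) x).toReal * g k t ω x with hF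
  have hFd : ∀ k t ω, F k t ω = (X ω).surplusDrift M H K δ (fun k => π k ω) k t := fun k t ω => by
    simp only [hF, hg, Trajectory.surplusDrift, mul_neg, Finset.sum_neg_distrib]
    ring
  -- Both the surplus and its conditional mean lie in `[-H, H]`, so the increments have range `4 H`;
  -- there are `N H` of them, giving the denominator `8 N H ^ 3`.
  have key := measureReal_episodic_sum_ge_le_exp (μ := μ) (ℱ := ℱ) (F := F)
    (D := fun _ _ => Set.univ) (K := K) (H := H) (a := -(2 * H : ℝ)) (b := 2 * H) (by linarith)
    (by linarith) (by linarith)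
    (fun k hk t ht => by
      have hmono : ℱ (k * (H + 1) + t) ≤ ℱ (k * (H + 1) + (t + 1)) := ℱ.mono (by omega)
      have h1 : Measurable[ℱ (k * (H + 1) + (t + 1))] fun ω => g k t ω ((X ω).state k (t + 1)) :=
        @Measurable.apply_of_countable _ _ _ (ℱ (k * (H + 1) + (t + 1))) _ _ _ _
          (fun x ω => g k t ω x) _ (fun x => (hgm k hk t ht x).mono hmono le_rfl)
          (I.measurable_state k hk (t + 1) ht)
      have h2 : Measurable[ℱ (k * (H + 1) + (t + 1))] fun ω =>
          ∑ x, (M.trans ((X ω).state k t) ((X ω).action k t) x).toReal * g k t ω x :=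
        Finset.measurable_fun_sum _ fun x _ => (Measurable.fun_mul
          (I.measurable_comp_visit hk ht fun s a => (M.trans s a x).toReal)
          (hgm k hk t ht x) :).mono hmono le_rfl
      exact Measurable.fun_sub h1 h2)
    (fun k hk t ht ω => by
      have h1 := abs_le.1 (hgC k t ω ((X ω).state k (t + 1)))
      have h2 : |∑ x, (M.trans ((X ω).state k t) ((X ω).action k t) x).toReal * g k t ω x| ≤ H := by
        refine (Finset.abs_sum_le_sum_abs _ _).trans ?_
        calc _ ≤ ∑ x, (M.trans ((X ω).state k t) ((X ω).action k t) x).toReal * (H : ℝ) := by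
              refine Finset.sum_le_sum fun x _ => ?_
              rw [abs_mul, abs_of_nonneg ENNReal.toReal_nonneg]
              exact mul_le_mul_of_nonneg_left (hgC k t ω x) ENNReal.toReal_nonneg
          _ = H := by rw [← Finset.sum_mul, PMF.sum_toReal_eq_one, one_mul]
      rw [abs_le] at h2
      simp only [hF]
      constructor <;> linarith [h1.1, h1.2, h2.1, h2.2])
    (fun k hk t ht => @MeasurableSet.univ _ (ℱ (k * (H + 1) + t)))
    (fun k hk t ht ω hω => absurd (Set.mem_univ ω) hω)
    (fun k hk t ht => I.condExp_sub_sum_trans hk ht (hgm k hk t ht) (hgC k t)) hN (x := x)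
    (v := N * H) hx (by positivity)
  refine (measureReal_mono ?_ (measure_ne_top _ _)).trans (key.trans (Real.exp_le_exp.2 ?_))
  · intro ω hω
    refine ⟨?_, by simp⟩
    simp only [hFd]
    exact hω
  · refine neg_le_neg (le_of_eq ?_)
    field_simp
    ring

end EpisodicInteraction

/-! ### Union bounds for the confidence intervals -/

/-- Holds since `3 > e`. It keeps the widths of an unvisited pair at least `1`, so the default
estimate `0` never violates them. -/
theorem one_le_log_mul_div {c y δ : ℝ} (hc : 3 ≤ c) (hy : 1 ≤ y) (hδ : 0 < δ) (hδ1 : δ < 1) :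
    1 ≤ Real.log (c * y / δ) := by
  have hx : 3 ≤ c * y / δ := by
    rw [le_div_iff₀ hδ]
    nlinarith
  rw [Real.le_log_iff_exp_le (by linarith)]
  linarith [Real.exp_one_lt_d9]

theorem one_le_card_mul_card_mul {S A : Type*} [Fintype S] [Fintype A] [Nonempty S] [Nonempty A]
    {H K : ℕ} (hH : 1 ≤ H) (hK : 1 ≤ K) :
    (1 : ℝ) ≤ Fintype.card S * Fintype.card A * (K * H : ℝ) := by
  exact_mod_cast Nat.mul_pos (Nat.mul_pos Fintype.card_pos Fintype.card_pos) (Nat.mul_pos hK hH)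

theorem FiniteMDP.trans_mem_stdSimplex {S A : Type*} [Fintype S] (M : FiniteMDP S A) (s : S)
    (a : A) : (fun x => (M.trans s a x).toReal) ∈ stdSimplex ℝ S :=
  ⟨fun _ => ENNReal.toReal_nonneg, (M.trans s a).sum_toReal_eq_one⟩

/-- The sign pattern of a set of states. -/
noncomputable def signVector {S : Type*} [DecidableEq S] (B : Finset S) (x : S) : ℝ :=
  if x ∈ B then 1 else -1

theorem abs_signVector_le {S : Type*} [DecidableEq S] (B : Finset S) (x : S) :
    |signVector B x| ≤ 1 := by
  rw [signVector]
  split_ifs <;> simp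

/-- The `L¹` norm is attained on one of `2 ^ S` sign vectors, so a union bound over them controls
it. -/
theorem exists_signVector_sum_eq {S : Type*} [Fintype S] [DecidableEq S] (v : S → ℝ) :
    ∃ B : Finset S, ∑ x, signVector B x * v x = ∑ x, |v x| := by
  classical
  refine ⟨Finset.univ.filter fun x => 0 ≤ v x, Finset.sum_congr rfl fun x _ => ?_⟩
  rcases le_or_gt 0 (v x) with h | h
  · simp [signVector, h, abs_of_nonneg h]
  · simp [signVector, not_le.2 h, abs_of_neg h]

namespace EpisodicInteraction

variable {S A Ω : Type*} [Fintype S] [Fintype A] [DecidableEq S] [DecidableEq A]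
  [MeasurableSpace S] [DiscreteMeasurableSpace S] [MeasurableSpace A] [DiscreteMeasurableSpace A]
  {mΩ : MeasurableSpace Ω} {μ : Measure Ω} [IsProbabilityMeasure μ]
  {M : FiniteMDP S A} {H K : ℕ} {δ : ℝ}
  {ℱ : Filtration ℕ mΩ} {X : Ω → Trajectory S A} {π : ℕ → Ω → ℕ → S → A}

variable (I : EpisodicInteraction M H K μ ℱ X π)
include I

/-- With `y = S A K H` there are `2 K y` events, indexed by episode, pair, tail and visit count. The
width makes each exponent `4 log (8 y / δ)`, so each has probability at most `(δ / (8 y)) ^ 4`. -/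
theorem measureReal_reward_fail_le [Nonempty S] [Nonempty A] (hH : 1 ≤ H) (hK : 1 ≤ K)
    (hδ : 0 < δ) (hδ1 : δ < 1) :
    μ.real {ω | ∃ k < K, ∃ s a,
      √(2 * Real.log (8 * Fintype.card S * Fintype.card A * (K * H : ℝ) / δ) /
        (max ((X ω).visits H k s a) 1 : ℕ)) < |(X ω).empReward H k s a - M.meanReward s a|} ≤
      δ / 8 := by
  set y : ℝ := Fintype.card S * Fintype.card A * (K * H : ℝ) with hy
  have hy1 : 1 ≤ y := one_le_card_mul_card_mul hH hK
  have hy8 : 8 * Fintype.card S * Fintype.card A * (K * H : ℝ) / δ = 8 * y / δ := by rw [hy]; ring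
  rw [hy8]
  set L := Real.log (8 * y / δ) with hL
  have hL1 : 1 ≤ L := one_le_log_mul_div (by norm_num) hy1 hδ hδ1
  have hmain := measureReal_le_card_mul (μ := μ)
    (Finset.range K ×ˢ (Finset.univ : Finset (S × A × Bool)) ×ˢ Finset.Icc 1 (K * H))
    (E := {ω | ∃ k < K, ∃ s a, √(2 * L / (max ((X ω).visits H k s a) 1 : ℕ)) <
        |(X ω).empReward H k s a - M.meanReward s a|})
    (f := fun i => {ω | (X ω).visits H i.1 i.2.1.1 i.2.1.2.1 = i.2.2 ∧ √(2 * L / i.2.2) ≤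
      (if i.2.1.2.2 then 1 else -1) *
        ((X ω).empReward H i.1 i.2.1.1 i.2.1.2.1 - M.meanReward i.2.1.1 i.2.1.2.1)})
    (c := (δ / (8 * y)) ^ 4) ?_ ?_
  · refine hmain.trans ?_
    simp only [Finset.card_product, Finset.card_range, Finset.card_univ, Fintype.card_prod,
      Fintype.card_bool, Nat.card_Icc, add_tsub_cancel_right]
    push_cast
    have hKy : (K : ℝ) ≤ y := by
      rw [hy]
      exact_mod_cast (by
        have h1 : 0 < Fintype.card S * Fintype.card A * H :=
          Nat.mul_pos (Nat.mul_pos Fintype.card_pos Fintype.card_pos) hH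
        calc K = 1 * K := (one_mul K).symm
          _ ≤ Fintype.card S * Fintype.card A * H * K := Nat.mul_le_mul_right K h1
          _ = Fintype.card S * Fintype.card A * (K * H) := by ring)
    have e : (K : ℝ) * (Fintype.card S * (Fintype.card A * 2) * (K * H)) * (δ / (8 * y)) ^ 4 =
        2 * (K : ℝ) * y * (δ / (8 * y)) ^ 4 := by rw [hy]; ring
    rw [e]
    have hδ4 : δ ^ 4 ≤ δ := pow_le_of_le_one hδ.le hδ1.le (by norm_num)
    calc 2 * (K : ℝ) * y * (δ / (8 * y)) ^ 4 ≤ 2 * y * y * (δ / (8 * y)) ^ 4 := by gcongr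
      _ = δ ^ 4 / (2048 * y ^ 2) := by field_simp; ring
      _ ≤ δ / 8 := by
        gcongr
        nlinarith
  · rintro ω ⟨k, hk, s, a, hω⟩
    have hn0 : (X ω).visits H k s a ≠ 0 := by
      intro h0
      have hr : (X ω).empReward H k s a = 0 := by simp [Trajectory.empReward, h0]
      have hm := M.meanReward_mem_Icc s a
      rw [h0, hr, zero_sub, abs_neg, abs_of_nonneg hm.1] at hω
      have : 1 ≤ √(2 * L / (max 0 1 : ℕ)) := by
        rw [Real.one_le_sqrt]
        simp
        linarith
      linarith [hm.2]
    rw [max_eq_left (Nat.one_le_iff_ne_zero.2 hn0)] at hω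
    simp only [Set.mem_iUnion]
    refine ⟨(k, (s, a, decide (0 ≤ (X ω).empReward H k s a - M.meanReward s a)),
      (X ω).visits H k s a), ?_, rfl, ?_⟩
    · simp only [Finset.mem_product, Finset.mem_range, Finset.mem_univ, true_and, Finset.mem_Icc]
      exact ⟨hk, Nat.one_le_iff_ne_zero.2 hn0,
        ((X ω).visits_le H k s a).trans (Nat.mul_le_mul_right H hk.le)⟩
    · refine hω.le.trans (le_of_eq ?_)
      rcases le_or_gt 0 ((X ω).empReward H k s a - M.meanReward s a) with h | h
      · simp only [h, decide_true, if_true, one_mul, abs_of_nonneg h]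
      · simp only [not_le.2 h, decide_false, Bool.false_eq_true, if_false, abs_of_neg h]
        ring
  · rintro ⟨k, ⟨s, a, σ⟩, n⟩ hi
    simp only [Finset.mem_product, Finset.mem_range, Finset.mem_univ, true_and,
      Finset.mem_Icc] at hi
    obtain ⟨hk, hn, -⟩ := hi
    have hn' : (0 : ℝ) < n := by exact_mod_cast hn
    refine (I.measureReal_empReward_sub_ge_le hk.le s a σ hn (Real.sqrt_nonneg _)).trans
      (le_of_eq ?_)
    rw [Real.sq_sqrt (by positivity)]
    have e : -(2 * n * (2 * L / n)) = (4 : ℕ) * Real.log (δ / (8 * y)) := by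
      rw [← inv_div (8 * y) δ, Real.log_inv, ← hL]
      field_simp
      norm_num
    rw [e, Real.exp_nat_mul, Real.exp_log (by positivity)]

/-- The factor `S` in the squared radius pays for the `2 ^ S` sign vectors: each event has
probability at most `(δ / (12 y)) ^ (2 S)`, and there are `K y 2 ^ S` of them. -/
theorem measureReal_trans_fail_le [Nonempty S] [Nonempty A] (hH : 1 ≤ H) (hK : 1 ≤ K)
    (hδ : 0 < δ) (hδ1 : δ < 1) :
    μ.real {ω | ∃ k < K, ∃ s a,
      √(4 * Fintype.card S *
        Real.log (12 * Fintype.card S * Fintype.card A * (K * H : ℝ) / δ) /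
        (max ((X ω).visits H k s a) 1 : ℕ)) <
          ∑ x, |(M.trans s a x).toReal - (X ω).empTrans H k s a x|} ≤ δ / 8 := by
  set y : ℝ := Fintype.card S * Fintype.card A * (K * H : ℝ) with hy
  have hy1 : 1 ≤ y := one_le_card_mul_card_mul hH hK
  have hy12 : 12 * Fintype.card S * Fintype.card A * (K * H : ℝ) / δ = 12 * y / δ := by
    rw [hy]; ring
  rw [hy12]
  set L := Real.log (12 * y / δ) with hL
  have hL1 : 1 ≤ L := one_le_log_mul_div (by norm_num) hy1 hδ hδ1
  have hS1 : (1 : ℝ) ≤ Fintype.card S := by exact_mod_cast Fintype.card_pos (α := S)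
  have hmain := measureReal_le_card_mul (μ := μ)
    (Finset.range K ×ˢ (Finset.univ : Finset (S × A × Finset S)) ×ˢ Finset.Icc 1 (K * H))
    (E := {ω | ∃ k < K, ∃ s a,
      √(4 * Fintype.card S * L / (max ((X ω).visits H k s a) 1 : ℕ)) <
        ∑ x, |(M.trans s a x).toReal - (X ω).empTrans H k s a x|})
    (f := fun i => {ω | (X ω).visits H i.1 i.2.1.1 i.2.1.2.1 = i.2.2 ∧
      √(4 * Fintype.card S * L / i.2.2) ≤ ∑ x, signVector i.2.1.2.2 x *
        ((X ω).empTrans H i.1 i.2.1.1 i.2.1.2.1 x - (M.trans i.2.1.1 i.2.1.2.1 x).toReal)})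
    (c := (δ / (12 * y)) ^ (2 * Fintype.card S)) ?_ ?_
  · refine hmain.trans ?_
    simp only [Finset.card_product, Finset.card_range, Finset.card_univ, Fintype.card_prod,
      Fintype.card_finset, Nat.card_Icc, add_tsub_cancel_right]
    push_cast
    have hKy : (K : ℝ) ≤ y := by
      rw [hy]
      exact_mod_cast (by
        have h1 : 0 < Fintype.card S * Fintype.card A * H :=
          Nat.mul_pos (Nat.mul_pos Fintype.card_pos Fintype.card_pos) hH
        calc K = 1 * K := (one_mul K).symm
          _ ≤ Fintype.card S * Fintype.card A * H * K := Nat.mul_le_mul_right K h1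
          _ = Fintype.card S * Fintype.card A * (K * H) := by ring)
    have e : (K : ℝ) * (Fintype.card S * (Fintype.card A * 2 ^ Fintype.card S) * (K * H)) *
        (δ / (12 * y)) ^ (2 * Fintype.card S) =
        (K : ℝ) * y * (2 * (δ / (12 * y)) ^ 2) ^ Fintype.card S := by
      rw [hy, mul_pow 2, ← pow_mul]; ring
    rw [e]
    have hz : δ / (12 * y) ≤ 1 / 12 := by
      rw [div_le_div_iff₀ (by positivity) (by norm_num)]
      linarith
    have hz0 : 0 ≤ δ / (12 * y) := by positivity
    -- The base is below `1`, so one factor suffices; its `y ^ 2` in the denominator cancels `K y ≤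
    -- y ^ 2`.
    have hpow : (2 * (δ / (12 * y)) ^ 2) ^ Fintype.card S ≤ 2 * (δ / (12 * y)) ^ 2 :=
      pow_le_of_le_one (by positivity) (by nlinarith) Fintype.card_ne_zero
    calc (K : ℝ) * y * (2 * (δ / (12 * y)) ^ 2) ^ Fintype.card S
        ≤ y * y * (2 * (δ / (12 * y)) ^ 2) := by gcongr
      _ = δ ^ 2 / 72 := by field_simp; ring
      _ ≤ δ / 8 := by nlinarith
  · rintro ω ⟨k, hk, s, a, hω⟩
    have hn0 : (X ω).visits H k s a ≠ 0 := by
      intro h0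
      have hp : ∀ x, (X ω).empTrans H k s a x = 0 := fun x => by simp [Trajectory.empTrans, h0]
      have h1 : ∑ x, |(M.trans s a x).toReal - (X ω).empTrans H k s a x| = 1 := by
        rw [← (M.trans s a).sum_toReal_eq_one]
        exact Finset.sum_congr rfl fun x _ => by
          rw [hp, sub_zero, abs_of_nonneg ENNReal.toReal_nonneg]
      rw [h0, h1] at hω
      have : 1 ≤ √(4 * Fintype.card S * L / (max 0 1 : ℕ)) := by
        rw [Real.one_le_sqrt]
        simp
        nlinarith
      linarith
    rw [max_eq_left (Nat.one_le_iff_ne_zero.2 hn0)] at hω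
    obtain ⟨B, hB⟩ := exists_signVector_sum_eq fun x =>
      (X ω).empTrans H k s a x - (M.trans s a x).toReal
    simp only [Set.mem_iUnion]
    refine ⟨(k, (s, a, B), (X ω).visits H k s a), ?_, rfl, ?_⟩
    · simp only [Finset.mem_product, Finset.mem_range, Finset.mem_univ, true_and, Finset.mem_Icc]
      exact ⟨hk, Nat.one_le_iff_ne_zero.2 hn0,
        ((X ω).visits_le H k s a).trans (Nat.mul_le_mul_right H hk.le)⟩
    · refine hω.le.trans (le_of_eq ?_)
      rw [hB]
      exact Finset.sum_congr rfl fun x _ => abs_sub_comm _ _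
  · rintro ⟨k, ⟨s, a, B⟩, n⟩ hi
    simp only [Finset.mem_product, Finset.mem_range, Finset.mem_univ, true_and,
      Finset.mem_Icc] at hi
    obtain ⟨hk, hn, -⟩ := hi
    have hn' : (0 : ℝ) < n := by exact_mod_cast hn
    refine (I.measureReal_empTrans_sub_ge_le hk.le s a (abs_signVector_le B) hn
      (Real.sqrt_nonneg _)).trans (le_of_eq ?_)
    rw [Real.sq_sqrt (by positivity)]
    have e : -(n * (4 * Fintype.card S * L / n) / 2) =
        (2 * Fintype.card S : ℕ) * Real.log (δ / (12 * y)) := by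
      rw [← inv_div (12 * y) δ, Real.log_inv, ← hL]
      push_cast
      field_simp
      ring
    rw [e, Real.exp_nat_mul, Real.exp_log (by positivity)]

/-- With high probability all the confidence intervals hold. -/
theorem measureReal_not_concentrated_le [Nonempty S] [Nonempty A] (hH : 1 ≤ H) (hK : 1 ≤ K)
    (hδ : 0 < δ) (hδ1 : δ < 1) :
    μ.real {ω | ¬ (X ω).Concentrated M H K δ} ≤ δ / 4 := by
  have h1 := I.measureReal_reward_fail_le hH hK hδ hδ1
  have h2 := I.measureReal_trans_fail_le hH hK hδ hδ1
  refine (measureReal_mono ?_ (measure_ne_top _ _)).trans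
    ((measureReal_union_le _ _).trans ((add_le_add h1 h2).trans (by linarith)))
  intro ω hω
  by_contra hcon
  rw [Set.mem_union, not_or] at hcon
  simp only [Set.mem_ofPred_eq, not_exists, not_and, not_lt] at hcon
  exact hω ⟨hcon.1, fun k hk s a => ⟨M.trans_mem_stdSimplex s a, hcon.2 k hk s a⟩⟩

end EpisodicInteraction

/-! ### Final arithmetic and the regret bound -/

/-- The arithmetic that turns the three parts of the regret into the stated bound. -/
theorem regret_terms_le {S A H N T L L₁ L₂ L₃ : ℝ} (hS : 1 ≤ S) (hA : 1 ≤ A) (hH : 1 ≤ H)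
    (hN : 0 ≤ N) (hT : 0 ≤ T) (hNT : N * H ≤ T + H) (hL : Real.log 2 ≤ L) (h₁ : L₁ ≤ 3 * L)
    (h₂ : L₂ ≤ 4 * L) (h₃ : L₃ ≤ L) :
    S * H ^ 2 + (2 * √(2 * L₁) + 2 * H * √(4 * S * L₂)) *
        (3 * √(S * A * (N * H)) + 2 * H * S * A) + √(8 * N * H ^ 3 * L₃) ≤
      138 * (H * S * √(A * T) + H ^ 2 * √S * S * A) * L := by
  have hL0 : 1 / 2 ≤ L := by linarith [Real.log_two_gt_d9]
  have hL0' : 0 ≤ L := by linarith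
  set u := √S with hu
  set l := √L with hl
  have hu1 : 1 ≤ u := by rw [hu, Real.one_le_sqrt]; exact hS
  have hl0 : 0 ≤ l := Real.sqrt_nonneg _
  -- Turns every `√L` into a multiple of `L`, so that the first power of the logarithm suffices.
  have hl2 : l ≤ 2 * L := by
    rw [hl, Real.sqrt_le_left (by positivity)]
    nlinarith
  set w := √(A * (N * H)) with hw
  have hw0 : 0 ≤ w := Real.sqrt_nonneg _
  set q := √(A * T) with hq
  have hq0 : 0 ≤ q := Real.sqrt_nonneg _
  -- Rounding `T` up to whole episodes adds at most `H` steps; the cost `A H` goes into the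
  -- lower-order term.
  have hwq : w ≤ q + A * H := by
    calc w ≤ √(A * T + A * H) := Real.sqrt_le_sqrt (by nlinarith)
      _ ≤ q + √(A * H) := by
        rw [hq, Real.sqrt_le_left (by positivity), add_sq, Real.sq_sqrt (by positivity),
          Real.sq_sqrt (by positivity)]
        have : 0 ≤ 2 * √(A * T) * √(A * H) := by positivity
        linarith
      _ ≤ q + A * H := by
        have hAH : 1 ≤ A * H := one_le_mul_of_one_le_of_one_le hA hH
        have : √(A * H) ≤ A * H := by
          rw [Real.sqrt_le_left (by positivity)]
          nlinarith
        linarith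
  have e1 : √(2 * L₁) ≤ 5 / 2 * l := by
    rw [Real.sqrt_le_left (by positivity), mul_pow, Real.sq_sqrt hL0']
    linarith
  have e2 : √(4 * S * L₂) ≤ 4 * (u * l) := by
    rw [Real.sqrt_le_left (by positivity), mul_pow, mul_pow, Real.sq_sqrt hL0',
      Real.sq_sqrt (by linarith)]
    have := mul_le_mul_of_nonneg_left h₂ (show 0 ≤ 4 * S by linarith)
    linarith
  have e3 : √(S * A * (N * H)) = u * w := by
    rw [mul_assoc, Real.sqrt_mul (by linarith)]
  have e4 : √(8 * N * H ^ 3 * L₃) ≤ 3 * (H * w * l) := by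
    rw [Real.sqrt_le_left (by positivity), mul_pow, mul_pow, mul_pow, Real.sq_sqrt hL0',
      Real.sq_sqrt (by positivity)]
    have h5 : N * H ^ 3 * L₃ ≤ N * H ^ 3 * L := mul_le_mul_of_nonneg_left h₃ (by positivity)
    have h6 : N * H ^ 3 * L ≤ A * (N * H ^ 3 * L) :=
      le_mul_of_one_le_left (by positivity) hA
    have h7 : 0 ≤ N * H ^ 3 * L := by positivity
    nlinarith
  have hbonus : 2 * √(2 * L₁) + 2 * H * √(4 * S * L₂) ≤ 26 * (H * u * L) := by
    have hHu : 1 ≤ H * u := one_le_mul_of_one_le_of_one_le hH hu1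
    have h5 : 2 * H * √(4 * S * L₂) ≤ 2 * H * (4 * (u * l)) :=
      mul_le_mul_of_nonneg_left e2 (by linarith)
    have h6 : l ≤ H * u * l := le_mul_of_one_le_left hl0 hHu
    have h7 : H * u * l ≤ H * u * (2 * L) := mul_le_mul_of_nonneg_left hl2 (by linarith)
    linarith
  have hS2 : u * u = S := Real.mul_self_sqrt (by linarith)
  have hprod : (2 * √(2 * L₁) + 2 * H * √(4 * S * L₂)) *
        (3 * √(S * A * (N * H)) + 2 * H * S * A) ≤
      78 * (H * S * w * L) + 52 * (H ^ 2 * u * S * A * L) := by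
    rw [e3]
    refine (mul_le_mul_of_nonneg_right hbonus (by positivity)).trans (le_of_eq ?_)
    rw [← hS2]
    ring
  have hHS : 0 ≤ H * S := by positivity
  have hd : 3 * (H * w * l) ≤ 6 * (H * S * w * L) := by
    have h5 : H * w * l ≤ H * w * (2 * L) := mul_le_mul_of_nonneg_left hl2 (by positivity)
    have h6 : H * w * L ≤ S * (H * w * L) := le_mul_of_one_le_left (by positivity) hS
    linarith
  have hw' : H * S * w * L ≤ H * S * q * L + H ^ 2 * u * S * A * L := by
    have h5 : H * S * w ≤ H * S * (q + A * H) := mul_le_mul_of_nonneg_left hwq hHS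
    have h6 : H ^ 2 * S * A ≤ u * (H ^ 2 * S * A) := le_mul_of_one_le_left (by positivity) hu1
    have h7 : H * S * w ≤ H * S * q + H ^ 2 * u * S * A := by linarith
    have := mul_le_mul_of_nonneg_right h7 hL0'
    linarith
  have hfirst : S * H ^ 2 ≤ 2 * (H ^ 2 * u * S * A * L) := by
    have h5 : 1 ≤ u * A * (2 * L) := one_le_mul_of_one_le_of_one_le
      (one_le_mul_of_one_le_of_one_le hu1 hA) (by linarith)
    have h6 : S * H ^ 2 ≤ u * A * (2 * L) * (S * H ^ 2) :=
      le_mul_of_one_le_left (by positivity) h5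
    linarith
  -- The main term has coefficient `78 + 6 = 84` and the lower-order one `84 + 52 + 2 = 138`;
  -- positivity lets `138` serve for both.
  have hpos : 0 ≤ H * S * q * L := by positivity
  linarith

/-- Each extra factor `2` in the argument costs `log 2`, which is at most `log (2 y / δ)`. -/
theorem log_mul_div_le {y δ : ℝ} (hy : 1 ≤ y) (hδ : 0 < δ) (hδ1 : δ < 1) (j : ℕ) {c : ℝ}
    (hc0 : 0 < c) (hc : c ≤ 2 ^ (j + 1)) :
    Real.log (c * y / δ) ≤ (j + 1) * Real.log (2 * y / δ) := by
  have hx : 2 ≤ 2 * y / δ := by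
    rw [le_div_iff₀ hδ]
    nlinarith
  have h2 : Real.log 2 ≤ Real.log (2 * y / δ) := Real.log_le_log (by norm_num) hx
  have h3 : c * y / δ ≤ 2 ^ j * (2 * y / δ) := by
    rw [← mul_div_assoc]
    gcongr ?_ / δ
    calc c * y ≤ 2 ^ (j + 1) * y := by gcongr
      _ = _ := by ring
  calc Real.log (c * y / δ) ≤ Real.log (2 ^ j * (2 * y / δ)) :=
        Real.log_le_log (by positivity) h3
    _ = j * Real.log 2 + Real.log (2 * y / δ) := by
        rw [Real.log_mul (by positivity) (by positivity), Real.log_pow]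
    _ ≤ (j + 1) * Real.log (2 * y / δ) := by
        have := mul_le_mul_of_nonneg_left h2 (Nat.cast_nonneg (α := ℝ) j)
        linarith

theorem mainTheorem5 :
    ∃ (C : ℝ) (m : ℕ), 0 < C ∧
      ∀ (S A Ω : Type*) [Fintype S] [Fintype A] [DecidableEq S] [DecidableEq A]
        [MeasurableSpace S] [DiscreteMeasurableSpace S]
        [MeasurableSpace A] [DiscreteMeasurableSpace A]
        [mΩ : MeasurableSpace Ω] (μ : Measure Ω) [IsProbabilityMeasure μ]
        (M : FiniteMDP S A) (H K : ℕ) (δ : ℝ)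
        (ℱ : Filtration ℕ mΩ) (X : Ω → Trajectory S A) (π : ℕ → Ω → ℕ → S → A),
        1 ≤ H → 1 ≤ K → 0 < δ → δ < 1 →
        EpisodicInteraction M H K μ ℱ X π → IsUCRL2GP H K δ X π →
        ∀ T : ℕ, T ≤ K * H →
          1 - δ ≤ μ.real {ω | regret M H X π T ω ≤
            C * (H * Fintype.card S * √(Fintype.card A * T)
                + H ^ 2 * √(Fintype.card S) * Fintype.card S * Fintype.card A)
              * Real.log (2 * Fintype.card S * Fintype.card A * H * K / δ) ^ m} := by
  refine ⟨138, 1, by norm_num, ?_⟩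
  intro S A Ω _ _ _ _ _ _ _ _ mΩ μ _ M H K δ ℱ X π hH hK hδ hδ1 I hG T hT
  have hΩ : Nonempty Ω := μ.nonempty_of_neZero
  obtain ⟨ω₀⟩ := hΩ
  have : Nonempty S := ⟨(X ω₀).state 0 0⟩
  have : Nonempty A := ⟨(X ω₀).action 0 0⟩
  set y : ℝ := Fintype.card S * Fintype.card A * (K * H : ℝ) with hy
  have hy1 : 1 ≤ y := one_le_card_mul_card_mul hH hK
  have hlog : Real.log (2 * Fintype.card S * Fintype.card A * H * K / δ) =
      Real.log (2 * y / δ) := by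
    rw [hy]; congr 1; ring
  have hL2 : Real.log 2 ≤ Real.log (2 * y / δ) := by
    refine Real.log_le_log (by norm_num) ?_
    rw [le_div_iff₀ hδ]
    nlinarith
  have hL0 : 0 ≤ Real.log (2 * y / δ) := (Real.log_nonneg (by norm_num)).trans hL2
  rw [hlog, pow_one]
  set N := T ⌈/⌉ H with hN
  have hNK : N ≤ K := by
    rw [hN, ceilDiv_le_iff_le_mul hH, mul_comm]
    exact hT
  have hNT : (N * H : ℝ) ≤ T + H := by
    have : N * H ≤ T + H := by
      rw [hN, Nat.ceilDiv_eq_add_pred_div]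
      exact (Nat.div_mul_le_self _ _).trans (by omega)
    exact_mod_cast this
  -- With no episode started the regret is zero; the drift tail bound needs `N > 0`.
  rcases Nat.eq_zero_or_pos N with hN0 | hN0
  · have huniv : {ω | regret M H X π T ω ≤
        138 * (H * Fintype.card S * √(Fintype.card A * T)
          + H ^ 2 * √(Fintype.card S) * Fintype.card S * Fintype.card A)
          * Real.log (2 * y / δ)} = Set.univ := by
      refine Set.eq_univ_of_forall fun ω => ?_
      rw [Set.mem_ofPred_eq, regret, ← hN, hN0, Finset.sum_range_zero]
      positivity
    rw [huniv, probReal_univ]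
    linarith
  -- The level at which the drift tail equals `δ / 2`.
  set x : ℝ := √(8 * N * (H : ℝ) ^ 3 * Real.log (2 / δ)) with hx
  have hdrift := I.measureReal_sum_surplusDrift_ge_le (δ := δ) hNK hN0 hH (Real.sqrt_nonneg
    (8 * N * (H : ℝ) ^ 3 * Real.log (2 / δ)))
  have hlogδ : 0 ≤ Real.log (2 / δ) := Real.log_nonneg (by rw [le_div_iff₀ hδ]; linarith)
  have hH' : (0 : ℝ) < H := by exact_mod_cast hH
  have hN' : (0 : ℝ) < N := by exact_mod_cast hN0
  have hexp : Real.exp (-(x ^ 2 / (8 * N * (H : ℝ) ^ 3))) = δ / 2 := by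
    rw [hx, Real.sq_sqrt (by positivity), mul_div_cancel_left₀ _ (by positivity), ← Real.log_inv,
      inv_div, Real.exp_log (by positivity)]
  rw [hexp] at hdrift
  have hconc := I.measureReal_not_concentrated_le hH hK hδ hδ1
  -- Subadditivity applied to this cover avoids measurability of the events; the two failure sets
  -- cost `δ / 4 + δ / 2 ≤ δ`.
  have hcover : (Set.univ : Set Ω) ⊆ {ω | regret M H X π T ω ≤
        138 * (H * Fintype.card S * √(Fintype.card A * T)
          + H ^ 2 * √(Fintype.card S) * Fintype.card S * Fintype.card A)
          * Real.log (2 * y / δ)} ∪ ({ω | ¬ (X ω).Concentrated M H K δ} ∪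
        {ω | x ≤ ∑ k ∈ Finset.range N, ∑ t ∈ Finset.range H,
          (X ω).surplusDrift M H K δ (fun k => π k ω) k t}) := by
    intro ω _
    by_contra hω
    simp only [Set.mem_union, Set.mem_ofPred_eq, not_or, not_not, not_le] at hω
    obtain ⟨h1, h2, h3⟩ := hω
    have hreg := Trajectory.sum_optValue_sub_value_le hH hK hδ hδ1 h2
      (p := fun k => π k ω) (fun k hk t ht s a => hG k hk t ht ω s a)
      (fun k hk t ht => I.action_eq k hk t ht ω) hNK
    have harith := regret_terms_le (S := Fintype.card S) (A := Fintype.card A) (H := H) (N := N)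
      (T := T) (L := Real.log (2 * y / δ)) (L₁ := Real.log (8 * y / δ))
      (L₂ := Real.log (12 * y / δ)) (L₃ := Real.log (2 / δ))
      (by exact_mod_cast Fintype.card_pos (α := S)) (by exact_mod_cast Fintype.card_pos (α := A))
      (by exact_mod_cast hH) hN'.le (Nat.cast_nonneg T) hNT hL2
      ((log_mul_div_le hy1 hδ hδ1 2 (by norm_num) (by norm_num)).trans_eq (by norm_num))
      ((log_mul_div_le hy1 hδ hδ1 3 (by norm_num) (by norm_num)).trans_eq (by norm_num))
      (Real.log_le_log (by positivity) (by gcongr; linarith))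
    have e8 : 8 * Fintype.card S * Fintype.card A * (K * H : ℝ) / δ = 8 * y / δ := by
      rw [hy]; ring
    have e12 : 12 * Fintype.card S * Fintype.card A * (K * H : ℝ) / δ = 12 * y / δ := by
      rw [hy]; ring
    rw [e8, e12] at hreg
    rw [regret, ← hN] at h1
    linarith
  have htotal := (measureReal_mono (μ := μ) hcover (measure_ne_top _ _)).trans
    ((measureReal_union_le _ _).trans (add_le_add le_rfl (measureReal_union_le _ _)))
  rw [probReal_univ] at htotal
  linarith
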